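/- Let $(K,v)$ be a non-trivially valued, algebraically closed field of characteristic $0$, with (additive) value group $\Gamma_K$ and maximal ideal $\mathcal{M}_K$, and let $(K,\mathcal{L})$ be an expansion of the structure $(K;+,-,\cdot,0,1,\mathrm{div})$, where $\mathrm{div}(x,y)$ means $v(x)\le v(y)$. "Definable" means $\mathcal{L}$-definable with parameters; a function $g\colon\Gamma_K\to\Gamma_K$ is definable if $\{(x,y)\in (K^\times)^2: v(y)=g(v(x))\}$ is. Open balls are the sets $\{x: v(x-a)>\gamma\}$ with $a\in K$, $\gamma\in\Gamma_K\cup\{-\infty\}$ (so $K$ is an open ball), closed balls are the sets $\{x: v(x-a)\ge\gamma\}$ with $a\in K$, $\gamma\in\Gamma_K\cup\{+\infty\}$; a ball is an open or a closed ball. Let $\mathrm{rv}\colon K\to \mathrm{RV}=K^\times/(1+\mathcal{M}_K)\cup\{0\}$ be the quotient map, extended by $\mathrm{rv}(0)=0$. Assume: 1. ($C$-minimality) in every $\mathcal{L}$-structure elementarily equivalent to $(K,\mathcal{L})$, every definable subset of the field is a boolean combination of balls; 2. (definable completeness) every definable family of nested balls of $K$ whose radii tend to $+\infty$ has non-empty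 intersection; 3. every definable function $g\colon\Gamma_K\to\Gamma_K$ is eventually $\mathbb{Q}$-linear: there are $\delta,\alpha\in\Gamma_K$ and $r\in\mathbb{Q}$ with $g(\gamma)=r\gamma+\alpha$ for all $\gamma>\delta$. Let $W\subseteq K^n$ be definable, let $X\subseteq W\times K$ be a definable set projecting onto $W$, with fibres $X_w=\{x:(w,x)\in X\}$, and let $f\colon X\to K$ be a definable function such that for every $w\in W$ the function $f_w=f(w,\cdot)\colon X_w\to K$ is a local $C$-isomorphism: every $x\in X_w$ lies in an open ball $B\subseteq X_w$ such that $f_w(B)$ is an open ball and, for all $x_1,x_2,x_3\in B$, $C(x_1,x_2,x_3)\Leftrightarrow C(f_w(x_1),f_w(x_2),f_w(x_3))$, where $C(x,y,z)$ means $v(x-y)=v(x-z)<v(y-z)$. Then there is a definable set $F\subseteq X$ such that for every $w\in W$ the fibre $F_w$ is finite and $f_w|(X_w\setminus F_w)$ has locally the Jacobian property, that is, every $x\in X_w\setminus F_w$ lies in an open ball $B\subseteq X_w\setminus F_w$ such that * (i) $f_w|B$ is injective and $f_w(B)$ is an open ball; * (ii) $f_w|B$ is differentiable (for the valuation topology)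 and its derivative $f_w'$ has no zero on $B$; * (iii) $\mathrm{rv}(f_w'(y))$ is constant on $B$, say equal to $c$; * (iv) $\mathrm{rv}(f_w(y)-f_w(z))=\mathrm{rv}(y-z)\,c$ for all $y,z\in B$. -/

import Mathlib

open FirstOrder FirstOrder.Language FirstOrder.Language.Structure

universe u₁ u₂ w w'

/-! ### The language of valued fields and its expansions -/

/-- The only relation symbol of the language of valued fields: the binary predicate `div`. -/
inductive DivRel : ℕ → Type
  | div : DivRel 2

/-- The language `(+, -, ·, 0, 1, div)` of valued fields. -/
def Ldiv : FirstOrder.Language.{0, 0} := ⟨FirstOrder.Language.ring.Functions, DivRel⟩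

namespace Ldiv

def addSymb : Ldiv.Functions 2 := ringFunc.add
def mulSymb : Ldiv.Functions 2 := ringFunc.mul
def negSymb : Ldiv.Functions 1 := ringFunc.neg
def zeroSymb : Ldiv.Functions 0 := ringFunc.zero
def oneSymb : Ldiv.Functions 0 := ringFunc.one
def divSymb : Ldiv.Relations 2 := DivRel.div

end Ldiv

section Expansion

variable {L : FirstOrder.Language.{u₁, u₂}} (φ : Ldiv →ᴸ L)

/-- The `L`-structure on the field `K` expands the valued field `(K, v)`: along `φ : Ldiv →ᴸ L` the
symbols of the language of valued fields have their usual meaning, `div (x, y)` being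
`v x ≤ v y`. -/
structure ExpandsValuedField {K : Type w} [Field K] {Γ : Type w'} [AddCommGroup Γ] [LinearOrder Γ]
    [IsOrderedAddMonoid Γ] (v : AddValuation K (WithTop Γ)) [L.Structure K] : Prop where
  map_add : ∀ x y : K, funMap (φ.onFunction Ldiv.addSymb) ![x, y] = x + y
  map_mul : ∀ x y : K, funMap (φ.onFunction Ldiv.mulSymb) ![x, y] = x * y
  map_neg : ∀ x : K, funMap (φ.onFunction Ldiv.negSymb) ![x] = -x
  map_zero : funMap (φ.onFunction Ldiv.zeroSymb) ![] = (0 : K)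
  map_one : funMap (φ.onFunction Ldiv.oneSymb) ![] = (1 : K)
  map_div : ∀ x y : K, RelMap (φ.onRelation Ldiv.divSymb) ![x, y] ↔ v x ≤ v y

variable (M : Type w) [L.Structure M]

/-- The difference `x - y`, computed with the symbols of the language. -/
def symbSub (x y : M) : M :=
  funMap (φ.onFunction Ldiv.addSymb) ![x, funMap (φ.onFunction Ldiv.negSymb) ![y] ]

/-- The relation `v x ≤ v y`, read from the symbol `div`. -/
def symbDiv (x y : M) : Prop :=
  RelMap (φ.onRelation Ldiv.divSymb) ![x, y]

/-- The balls of the valued field underlying an `L`-structure `M` (a structure elementarily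
equivalent to an expansion of a valued field), a radius being given as the value of some `c`:
the whole field, `{x | v c ≤ v (x - a)}` (a point if `c = 0`), and `{x | v c < v (x - a)}`
(empty if `c = 0`). -/
def symbBalls : Set (Set M) :=
  {S | S = Set.univ ∨ (∃ a c : M, S = {x | symbDiv φ M c (symbSub φ M x a)}) ∨
    ∃ a c : M, S = {x | ¬ symbDiv φ M (symbSub φ M x a) c}}

/-- `C`-minimality: in every structure elementarily equivalent to `M`, each subset definable with
parameters is a boolean combination of balls. -/
def IsCMinimal : Prop :=
  ∀ (N : Type w) [L.Structure N], M ≅[L] N →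
    ∀ S : Set N, (Set.univ : Set N).Definable₁ L S →
      S ∈ BooleanSubalgebra.closure (symbBalls φ N)

end Expansion

/-! ### Definable families, with parameters allowed everywhere -/

section Families

variable (L : FirstOrder.Language.{u₁, u₂}) {K : Type w} [L.Structure K] {n : ℕ}

/-- Definability of a subset of `Kⁿ × K`. -/
def DefinableProd (X : Set ((Fin n → K) × K)) : Prop :=
  (Set.univ : Set K).Definable L
    {q : Fin n ⊕ Fin 1 → K | ((fun i => q (Sum.inl i)), q (Sum.inr 0)) ∈ X}

/-- The fibre `X_w`. -/
def fiber (X : Set ((Fin n → K) × K)) (w : Fin n → K) : Set K := {x | (w, x) ∈ X}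

/-- `X ⊆ W × K` is a definable family of subsets of `K` parametrized by the definable set `W`. -/
structure IsDefinableFamily (W : Set (Fin n → K)) (X : Set ((Fin n → K) × K)) : Prop where
  base : (Set.univ : Set K).Definable L W
  total : DefinableProd L X
  proj : Prod.fst '' X = W

/-- `(w, x) ↦ f w x`, restricted to `X ⊆ Kⁿ × K`, is a definable function, that is, its graph is
definable; the values of `f` off `X` play no role. -/
def IsDefinableFunOn (X : Set ((Fin n → K) × K)) (f : (Fin n → K) → K → K) : Prop :=
  (Set.univ : Set K).Definable L
    {q : Fin n ⊕ Fin 2 → K | ((fun i => q (Sum.inl i)), q (Sum.inr 0)) ∈ X ∧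
      q (Sum.inr 1) = f (fun i => q (Sum.inl i)) (q (Sum.inr 0))}

end Families

/-! ### Balls, `C`-isomorphisms, `RV` and the Jacobian property -/

section ValuedField

variable {K : Type w} [Field K] {Γ : Type w'} [AddCommGroup Γ] [LinearOrder Γ]
  [IsOrderedAddMonoid Γ] (v : AddValuation K (WithTop Γ))

/-- The closed ball `{x | v (x - a) ≥ γ}`, with `γ ∈ Γ ∪ {+∞}`. -/
def closedBall (a : K) (γ : WithTop Γ) : Set K := {x | γ ≤ v (x - a)}

/-- The open ball `{x | v (x - a) > γ}`, with `γ ∈ Γ ∪ {-∞}`; for `γ = -∞` it is `K`. -/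
def openBall (a : K) (γ : WithBot Γ) : Set K :=
  {x | WithBot.map (fun g : Γ => (g : WithTop Γ)) γ < ((v (x - a) : WithTop Γ) : WithBot (WithTop Γ))}

def IsOpenBall (B : Set K) : Prop := ∃ (a : K) (γ : WithBot Γ), B = openBall v a γ

def IsBall (B : Set K) : Prop := (∃ (a : K) (γ : WithTop Γ), B = closedBall v a γ) ∨ IsOpenBall v B

/-- `B` is a ball, open or closed, with a radius greater than `γ`. -/
def IsBallOfRadiusGT (γ : Γ) (B : Set K) : Prop :=
  (∃ (a : K) (ρ : WithTop Γ), (γ : WithTop Γ) < ρ ∧ B = closedBall v a ρ) ∨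
    ∃ (a : K) (ρ : WithBot Γ), (γ : WithBot Γ) < ρ ∧ B = openBall v a ρ

/-- Every definable family of nested balls whose radii tend to `+∞` has a common point. -/
def IsDefinablyComplete (L : FirstOrder.Language.{u₁, u₂}) [L.Structure K] : Prop :=
  ∀ (n : ℕ) (W : Set (Fin n → K)) (X : Set ((Fin n → K) × K)), IsDefinableFamily L W X →
    (∀ w ∈ W, IsBall v (fiber X w)) →
    (∀ w ∈ W, ∀ w' ∈ W, fiber X w ⊆ fiber X w' ∨ fiber X w' ⊆ fiber X w) →
    (∀ γ : Γ, ∃ w ∈ W, IsBallOfRadiusGT v γ (fiber X w)) →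
    (⋂ w ∈ W, fiber X w).Nonempty

/-- Definability of a function on the value group: its graph, pulled back to `K × K` along the
valuation, is definable. -/
def IsDefinableGammaFun (L : FirstOrder.Language.{u₁, u₂}) [L.Structure K] (g : Γ → Γ) : Prop :=
  (Set.univ : Set K).Definable₂ L
    {p : K × K | ∃ γ : Γ, v p.1 = (γ : WithTop Γ) ∧ v p.2 = (g γ : WithTop Γ)}

/-- `g γ = r γ + α` for all large `γ`, where `r` is a rational number; the equation is multiplied
by the denominator of `r`. -/
def EventuallyQLinear (g : Γ → Γ) : Prop :=
  ∃ (δ α : Γ) (r : ℚ), ∀ γ : Γ, δ < γ → r.den • (g γ - α) = r.num • γ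

/-- The `C`-relation. -/
def CRel (x y z : K) : Prop := v (x - y) = v (x - z) ∧ v (x - z) < v (y - z)

/-- `f` restricted to the open ball `B` is a `C`-isomorphism. -/
def IsCIsoOn (f : K → K) (B : Set K) : Prop :=
  IsOpenBall v (f '' B) ∧
    ∀ x ∈ B, ∀ y ∈ B, ∀ z ∈ B, CRel v x y z ↔ CRel v (f x) (f y) (f z)

/-- `f` restricted to `X` is a local `C`-isomorphism. -/
def IsLocalCIsoOn (f : K → K) (X : Set K) : Prop :=
  ∀ x ∈ X, ∃ B : Set K, IsOpenBall v B ∧ x ∈ B ∧ B ⊆ X ∧ IsCIsoOn v f B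

/-- The subgroup `1 + 𝓜` of `Kˣ`. -/
def oneAddMax : Subgroup Kˣ where
  carrier := {a | 0 < v ((a : K) - 1)}
  one_mem' := by simp
  mul_mem' := by
    intro a b ha hb
    have e : ((a * b : Kˣ) : K) - 1 = (a - 1) * (b - 1) + ((a - 1) + (b - 1)) := by
      push_cast; ring
    simp only [Set.mem_ofPred_eq] at ha hb ⊢
    rw [e]
    refine lt_of_lt_of_le (lt_min ?_ (lt_min ha hb)) ((le_min (min_le_left _ _)
      ((min_le_right _ _).trans (v.map_add _ _))).trans (v.map_add _ _))
    rw [v.map_mul]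
    exact lt_of_lt_of_le ha (le_add_of_nonneg_right hb.le)
  inv_mem' := by
    intro a ha
    simp only [Set.mem_ofPred_eq] at ha ⊢
    have h1 : v (a : K) = 0 := by
      have e : (a : K) = 1 + (a - 1) := by ring
      rw [e, ← v.map_one]
      exact v.map_add_eq_of_lt_left (by rwa [v.map_one])
    have h2 : v ((a⁻¹ : Kˣ) : K) = 0 := by
      have := v.map_mul (a : K) ((a⁻¹ : Kˣ) : K)
      rw [Units.mul_inv, v.map_one, h1, zero_add] at this
      exact this.symm
    have e : ((a⁻¹ : Kˣ) : K) - 1 = ((a⁻¹ : Kˣ) : K) * (-(a - 1)) := by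
      rw [neg_sub, mul_sub, mul_one, Units.inv_mul]
    rw [e, v.map_mul, h2, zero_add, v.map_neg]
    exact ha

/-- The group `Kˣ / (1 + 𝓜)`. -/
def RVUnits : Type w := Kˣ ⧸ oneAddMax v

instance : CommGroup (RVUnits v) := inferInstanceAs (CommGroup (Kˣ ⧸ oneAddMax v))

/-- `RV = Kˣ / (1 + 𝓜) ∪ {0}`. -/
abbrev RV : Type w := WithZero (RVUnits v)

/-- The quotient map `Kˣ → Kˣ / (1 + 𝓜)`. -/
def rvUnit : Kˣ →* RVUnits v := QuotientGroup.mk' (oneAddMax v)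

open Classical in
/-- The map `rv : K → RV`. -/
noncomputable def rv (x : K) : RV v :=
  if h : x = 0 then 0 else (rvUnit v (Units.mk0 x h) : RV v)

/-- `d` is the derivative at `x`, for the valuation topology, of `f` restricted to `B`. -/
def HasValDerivOn (f : K → K) (B : Set K) (x d : K) : Prop :=
  ∀ γ : Γ, ∃ δ : Γ, ∀ y ∈ B, y ≠ x → (δ : WithTop Γ) < v (y - x) →
    (γ : WithTop Γ) < v ((f y - f x) / (y - x) - d)

/-- `f` restricted to the open ball `B` has the Jacobian property. -/
def HasJacobianProperty (f : K → K) (B : Set K) : Prop :=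
  Set.InjOn f B ∧ IsOpenBall v (f '' B) ∧
    ∃ f' : K → K, (∀ x ∈ B, HasValDerivOn v f B x (f' x) ∧ f' x ≠ 0) ∧
      ∃ c : RV v, (∀ x ∈ B, rv v (f' x) = c) ∧
        ∀ x ∈ B, ∀ y ∈ B, rv v (f x - f y) = rv v (x - y) * c

/-- `f` restricted to `X` has locally the Jacobian property. -/
def HasLocallyJacobianProperty (f : K → K) (X : Set K) : Prop :=
  ∀ x ∈ X, ∃ B : Set K, IsOpenBall v B ∧ x ∈ B ∧ B ⊆ X ∧ HasJacobianProperty v f B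

end ValuedField

/-! ### A calculus of definable predicates and maps -/

/-! Call a point of `X_w` good if some ball around it lies in `X_w` and all difference quotients of
`f_w` on that ball fall in a single class `d(1 + 𝓜)`. Goodness is a first-order condition, so the
bad points form a definable set `F`. By `C`-minimality an infinite definable subset of `K` contains
a ball, so finiteness of `F_w` amounts to this: every ball on which `f_w` preserves the `C`-relation
contains a good point. It then remains to see that `f_w` has the Jacobian property near each good
point.

The main tool is `uniform_support`: by compactness, the members of a definable family of subsets of
`K` are described by the distances to a bounded number of centres. Closed balls have infinitely many
residue classes, so a counting argument with points in general position applies. It yields three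
facts. Each ball contains a ball inside one class of a given definable total preorder
(`preorder_ball`). A definable function bounded near `0` is Cauchy there, hence has a limit by
definable completeness (`cauchy`, `exists_limit`). A bounded definable map from a ball to residue
classes is constant on a subball (`exists_ball_const_residue`).

To find a good point, eventual linearity on the value group gives a subball where `v(f y - f z) = r
v(y - z) + α` with `r > 0` (`exists_ball_qLinear`). In characteristic `0` necessarily `r = 1`
(`eq_one_of_qLinear`): if `r = m/n` and `u` is the increment of `f`, then `u(s)^n / s^m` is Cauchy
at `0`, and comparing its values at `s` and `(1 + e)s` forces `m = n`. So difference quotients have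
constant value; their residue class stabilises as the increment shrinks, and is then constant on a
subball (`exists_ball_almost_affine`). Near a good point the derivative exists as a limit, and the
local `C`-isomorphism makes images of small balls into balls (`exists_hasJacobianProperty`). -/

/-- A context: a type identified with a finite power of `K`. -/
class Ctx (K : Type w) (α : Type w) where
  Ix : Type
  fin : Finite Ix
  equiv : α ≃ (Ix → K)

attribute [instance] Ctx.fin

instance Ctx.pi (K : Type w) (n : ℕ) : Ctx K (Fin n → K) := ⟨Fin n, inferInstance, Equiv.refl _⟩

instance Ctx.one (K : Type w) : Ctx K K := ⟨Unit, inferInstance, (Equiv.funUnique Unit K).symm⟩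

/-- The extension of a context by one variable. -/
instance Ctx.prod (K : Type w) (α β : Type w) [Ctx K α] [Ctx K β] : Ctx K (α × β) :=
  ⟨Ctx.Ix K α ⊕ Ctx.Ix K β, inferInstance,
    (Equiv.prodCongr Ctx.equiv Ctx.equiv).trans (Equiv.sumArrowEquivProdArrow _ _ _).symm⟩

section Calculus

variable (L : FirstOrder.Language.{u₁, u₂}) (K : Type w) [L.Structure K]

/-- A predicate on a context is definable (with parameters). -/
def Dfn {α : Type w} [Ctx K α] (P : α → Prop) : Prop :=
  (Set.univ : Set K).Definable L {x : Ctx.Ix K α → K | P (Ctx.equiv.symm x)}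

/-- A map between contexts is definable (with parameters). -/
def DMap {α β : Type w} [Ctx K α] [Ctx K β] (t : α → β) : Prop :=
  (Set.univ : Set K).DefinableMap L
    (fun x : Ctx.Ix K α → K => Ctx.equiv (K := K) (t (Ctx.equiv.symm x)))

variable {L K} {α β γ : Type w} [Ctx K α] [Ctx K β] [Ctx K γ]

theorem Dfn.comp {P : β → Prop} (hP : Dfn L K P) {t : α → β} (ht : DMap L K t) :
    Dfn L K fun a => P (t a) := by
  unfold Dfn
  convert! Set.Definable.preimage_map ht hP using 1
  ext x
  simp

theorem DMap.comp {s : β → γ} (hs : DMap L K s) {t : α → β} (ht : DMap L K t) :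
    DMap L K fun a => s (t a) := by
  intro i
  have := Set.DefinableFun.comp ht (hs i)
  simpa using this

theorem Dfn.not {P : α → Prop} (hP : Dfn L K P) : Dfn L K fun a => ¬ P a :=
  Set.Definable.compl hP

theorem Dfn.and {P Q : α → Prop} (hP : Dfn L K P) (hQ : Dfn L K Q) :
    Dfn L K fun a => P a ∧ Q a :=
  Set.Definable.inter hP hQ

theorem Dfn.or {P Q : α → Prop} (hP : Dfn L K P) (hQ : Dfn L K Q) :
    Dfn L K fun a => P a ∨ Q a :=
  Set.Definable.union hP hQ

theorem Dfn.imp {P Q : α → Prop} (hP : Dfn L K P) (hQ : Dfn L K Q) :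
    Dfn L K fun a => P a → Q a := by
  simpa only [imp_iff_not_or] using hP.not.or hQ

theorem Dfn.ex {P : α → β → Prop} (hP : Dfn L K fun p : α × β => P p.1 p.2) :
    Dfn L K fun a => ∃ y, P a y := by
  unfold Dfn at hP ⊢
  convert! Set.Definable.exists_of_finite hP using 1
  ext x
  simp only [Set.mem_ofPred_eq]
  rw [← (Ctx.equiv (K := K) (α := β)).symm.exists_congr_right]
  rfl

theorem Dfn.all {P : α → β → Prop} (hP : Dfn L K fun p : α × β => P p.1 p.2) :
    Dfn L K fun a => ∀ y, P a y := by
  simpa only [not_exists, not_not] using (Dfn.ex (P := fun a y => ¬ P a y) hP.not).not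

theorem DMap.id : DMap L K fun a : α => a := by
  intro i
  simpa using Set.DefinableFun.proj L

theorem DMap.pair {s : α → β} {t : α → γ} (hs : DMap L K s) (ht : DMap L K t) :
    DMap L K fun a => (s a, t a) := by
  rintro (i | i)
  · exact hs i
  · exact ht i

theorem DMap.fst {t : α → β × γ} (ht : DMap L K t) : DMap L K fun a => (t a).1 :=
  fun i => ht (Sum.inl i)

theorem DMap.snd {t : α → β × γ} (ht : DMap L K t) : DMap L K fun a => (t a).2 :=
  fun i => ht (Sum.inr i)

theorem DMap.const (c : β) : DMap L K fun _ : α => c :=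
  fun i => L.definableFun_const (Ctx.Ix K α) (Set.mem_univ (Ctx.equiv (K := K) c i))

/-- A `K`-valued map is definable if its graph is. -/
theorem DMap.of_graph {t : α → K} (h : Dfn L K fun p : α × K => p.2 = t p.1) : DMap L K t := by
  intro i
  have := Set.Definable.preimage_comp
    (fun j : Ctx.Ix K α ⊕ Unit => Sum.elim some (fun _ => none) j) h
  unfold Set.DefinableFun
  convert! this using 1
  ext x
  exact eq_comm

theorem DMap.eq {s t : α → K} (hs : DMap L K s) (ht : DMap L K t) : Dfn L K fun a => s a = t a :=
  Set.DefinableFun.ofPred_eq (hs ()) (ht ())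

theorem Dfn.comp₂ {R : β → γ → Prop} (hR : Dfn L K fun p : β × γ => R p.1 p.2) {s : α → β}
    {t : α → γ} (hs : DMap L K s) (ht : DMap L K t) : Dfn L K fun a => R (s a) (t a) :=
  hR.comp (hs.pair ht)

theorem DMap.funSymb₁ (g : L.Functions 1) {t : α → K} (ht : DMap L K t) :
    DMap L K fun a => funMap g ![t a] := by
  intro i
  have : (Set.univ : Set K).DefinableMap L
      (fun x : Ctx.Ix K α → K => ![t (Ctx.equiv.symm x)]) := by
    intro j; fin_cases j; exact ht ()
  exact Set.DefinableFun.comp this (Set.DefinableFun.of_empty (Set.DefinableFun.fun_symbol g))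

theorem DMap.funSymb₂ (g : L.Functions 2) {s t : α → K} (hs : DMap L K s) (ht : DMap L K t) :
    DMap L K fun a => funMap g ![s a, t a] := by
  intro i
  have : (Set.univ : Set K).DefinableMap L
      (fun x : Ctx.Ix K α → K => ![s (Ctx.equiv.symm x), t (Ctx.equiv.symm x)]) := by
    intro j; fin_cases j
    · exact hs ()
    · exact ht ()
  exact Set.DefinableFun.comp this (Set.DefinableFun.of_empty (Set.DefinableFun.fun_symbol g))

theorem Dfn.relSymb₂ (r : L.Relations 2) {s t : α → K} (hs : DMap L K s) (ht : DMap L K t) :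
    Dfn L K fun a => RelMap r ![s a, t a] := by
  have : (Set.univ : Set K).DefinableMap L
      (fun x : Ctx.Ix K α → K => ![s (Ctx.equiv.symm x), t (Ctx.equiv.symm x)]) := by
    intro j; fin_cases j
    · exact hs ()
    · exact ht ()
  have h2 : (Set.univ : Set K).Definable L {x : Fin 2 → K | RelMap r x} := by
    refine Set.Definable.mono ?_ (Set.empty_subset _)
    rw [Set.empty_definable_iff]
    refine ⟨r.formula Term.var, ?_⟩
    ext x
    simp [Formula.realize_rel]
  exact Set.Definable.preimage_map this h2

theorem dfn_iff_definableProd {n : ℕ} {X : Set ((Fin n → K) × K)} :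
    DefinableProd L X ↔ Dfn L K fun p : (Fin n → K) × K => p ∈ X :=
  ⟨fun h => Set.Definable.preimage_comp (Sum.map id fun _ : Fin 1 => ()) h,
    fun h => Set.Definable.preimage_comp (Sum.map id fun _ : Unit => (0 : Fin 1)) h⟩

theorem DMap.apply {n : ℕ} {t : α → Fin n → K} (ht : DMap L K t) (i : Fin n) :
    DMap L K fun a => t a i :=
  fun _ => ht i

end Calculus

/-- The standing hypotheses on the expanded valued field. -/
structure TameField {L : FirstOrder.Language.{u₁, u₂}} (φ : Ldiv →ᴸ L) {K : Type w} [Field K]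
    [L.Structure K] {Γ : Type w'} [AddCommGroup Γ] [LinearOrder Γ] [IsOrderedAddMonoid Γ]
    (v : AddValuation K (WithTop Γ)) : Prop where
  surj : Function.Surjective v
  expands : ExpandsValuedField φ v
  cMinimal : IsCMinimal φ K
  complete : IsDefinablyComplete v L
  qLinear : ∀ g : Γ → Γ, IsDefinableGammaFun v L g → EventuallyQLinear g

/-! ### Definability of the field operations and of comparisons of values. -/

section Field

variable {L : FirstOrder.Language.{u₁, u₂}} {φ : Ldiv →ᴸ L} {K : Type w} [Field K]
    [L.Structure K] {Γ : Type w'} [AddCommGroup Γ] [LinearOrder Γ] [IsOrderedAddMonoid Γ]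
    {v : AddValuation K (WithTop Γ)} {α : Type w} [Ctx K α] (T : TameField φ v)
include T

namespace TameField

theorem add {s t : α → K} (hs : DMap L K s) (ht : DMap L K t) :
    DMap L K fun a => s a + t a := by
  simpa only [T.expands.map_add] using DMap.funSymb₂ (φ.onFunction Ldiv.addSymb) hs ht

theorem mul {s t : α → K} (hs : DMap L K s) (ht : DMap L K t) :
    DMap L K fun a => s a * t a := by
  simpa only [T.expands.map_mul] using DMap.funSymb₂ (φ.onFunction Ldiv.mulSymb) hs ht

theorem neg {t : α → K} (ht : DMap L K t) : DMap L K fun a => - t a := by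
  simpa only [T.expands.map_neg] using DMap.funSymb₁ (φ.onFunction Ldiv.negSymb) ht

theorem sub {s t : α → K} (hs : DMap L K s) (ht : DMap L K t) :
    DMap L K fun a => s a - t a := by
  simpa only [sub_eq_add_neg] using T.add hs (T.neg ht)

theorem pow {t : α → K} (ht : DMap L K t) (n : ℕ) : DMap L K fun a => t a ^ n := by
  induction n with
  | zero => simpa only [pow_zero] using DMap.const (1 : K)
  | succ n ih => simpa only [pow_succ] using T.mul ih ht

theorem div {s t : α → K} (hs : DMap L K s) (ht : DMap L K t) :
    DMap L K fun a => s a / t a := by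
  refine DMap.of_graph ?_
  have : ∀ p : α × K, p.2 = s p.1 / t p.1 ↔
      ((¬ t p.1 = 0) ∧ p.2 * t p.1 = s p.1) ∨ (t p.1 = 0 ∧ p.2 = 0) := by
    intro p
    by_cases h : t p.1 = 0
    · simp [h]
    · simp [h, eq_div_iff]
  simp only [this]
  have h1 : DMap L K fun p : α × K => s p.1 := hs.comp (DMap.fst DMap.id)
  have h2 : DMap L K fun p : α × K => t p.1 := ht.comp (DMap.fst DMap.id)
  have h3 : DMap L K fun p : α × K => p.2 := DMap.snd DMap.id
  exact ((h2.eq (DMap.const 0)).not.and ((T.mul h3 h2).eq h1)).or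
    ((h2.eq (DMap.const 0)).and (h3.eq (DMap.const 0)))

theorem v_le {s t : α → K} (hs : DMap L K s) (ht : DMap L K t) :
    Dfn L K fun a => v (s a) ≤ v (t a) := by
  simpa only [T.expands.map_div] using Dfn.relSymb₂ (φ.onRelation Ldiv.divSymb) hs ht

theorem v_lt {s t : α → K} (hs : DMap L K s) (ht : DMap L K t) :
    Dfn L K fun a => v (s a) < v (t a) := by
  simpa only [not_le] using (T.v_le ht hs).not

theorem v_eq {s t : α → K} (hs : DMap L K s) (ht : DMap L K t) :
    Dfn L K fun a => v (s a) = v (t a) := by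
  simpa only [le_antisymm_iff] using (T.v_le hs ht).and (T.v_le ht hs)

theorem v_le_const {s : α → K} (hs : DMap L K s) (γ : WithTop Γ) :
    Dfn L K fun a => v (s a) ≤ γ := by
  obtain ⟨c, rfl⟩ := T.surj γ
  exact T.v_le hs (DMap.const c)

theorem const_le_v {s : α → K} (hs : DMap L K s) (γ : WithTop Γ) :
    Dfn L K fun a => γ ≤ v (s a) := by
  obtain ⟨c, rfl⟩ := T.surj γ
  exact T.v_le (DMap.const c) hs

theorem const_lt_v {s : α → K} (hs : DMap L K s) (γ : WithTop Γ) :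
    Dfn L K fun a => γ < v (s a) := by
  simpa only [not_le] using (T.v_le_const hs γ).not

theorem v_eq_const {s : α → K} (hs : DMap L K s) (γ : WithTop Γ) :
    Dfn L K fun a => v (s a) = γ := by
  obtain ⟨c, rfl⟩ := T.surj γ
  exact T.v_eq hs (DMap.const c)

end TameField

end Field

/-! ### Points of an algebraically closed valued field in general position -/

section Valued

variable {K : Type w} [Field K] {Γ : Type w'} [AddCommGroup Γ] [LinearOrder Γ]
  [IsOrderedAddMonoid Γ] {v : AddValuation K (WithTop Γ)}

/-- If the two values differed, `v (y - y')` would be the smaller one, hence below `γ`. The bounds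
`≤ γ` express that `y` and `y'` avoid the residue class of `q` at radius `γ`. -/
theorem v_sub_eq_of_le {y y' q : K} {γ : WithTop Γ} (h : v (y - q) ≤ γ) (h' : v (y' - q) ≤ γ)
    (hy : γ ≤ v (y - y')) : v (y - q) = v (y' - q) := by
  by_contra hne
  rcases lt_or_gt_of_ne hne with hlt | hlt
  · have := v.map_sub_eq_of_lt_left hlt
    rw [sub_sub_sub_cancel_right] at this
    exact absurd (hy.trans (this.le)) (not_le.2 (hlt.trans_le h'))
  · have := v.map_sub_eq_of_lt_right hlt
    rw [sub_sub_sub_cancel_right] at this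
    exact absurd (hy.trans (this.le)) (not_le.2 (hlt.trans_le h))

theorem v_le_sub_of_le {x y z : K} {γ : WithTop Γ} (h : γ ≤ v (x - y)) (h' : γ ≤ v (y - z)) :
    γ ≤ v (x - z) := by
  have := v.map_le_add h h'
  rwa [sub_add_sub_cancel] at this

theorem v_lt_sub_of_lt {x y z : K} {γ : WithTop Γ} (h : γ < v (x - y)) (h' : γ < v (y - z)) :
    γ < v (x - z) := by
  have := v.map_lt_add h h'
  rwa [sub_add_sub_cancel] at this

theorem v_sub_eq_of_lt {x y z : K} (h : v (x - z) < v (x - y)) : v (y - z) = v (x - z) := by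
  have e : y - z = (x - z) - (x - y) := by ring
  rw [e, v.map_sub_eq_of_lt_left h]

/-- Take `t` with `∏ (t - q) = 1`, the product over the integral `q`. The values `v (t - q)` sum to
`0`; a negative `v t` would make them all negative, so they are nonnegative and hence all zero. -/
theorem exists_unit_far [IsAlgClosed K] (Q : Finset K) :
    ∃ t : K, v t = 0 ∧ ∀ q ∈ Q, v (t - q) ≤ 0 := by
  classical
  -- Adding `0` makes the polynomial nonconstant and yields `v t = 0`; the points of negative value
  -- are dropped because an integral `t` is automatically far from them.
  set Q' : Finset K := insert 0 (Q.filter fun q => 0 ≤ v q) with hQ'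
  have h0 : (0 : K) ∈ Q' := Finset.mem_insert_self _ _
  set p : Polynomial K := ∏ q ∈ Q', (Polynomial.X - Polynomial.C q) with hp
  have hdeg : (p - 1).degree ≠ 0 := by
    have h1 : p.degree = Q'.card := by
      rw [hp, Polynomial.degree_prod]; simp
    have h2 : (0 : WithBot ℕ) < p.degree := by
      rw [h1]; exact_mod_cast Finset.card_pos.2 ⟨0, h0⟩
    rw [Polynomial.degree_sub_eq_left_of_degree_lt]
    · exact h2.ne'
    · rwa [Polynomial.degree_one]
  obtain ⟨t, ht⟩ := IsAlgClosed.exists_root _ hdeg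
  have hprod : ∏ q ∈ Q', (t - q) = 1 := by
    have := ht
    simp only [Polynomial.IsRoot, Polynomial.eval_sub, Polynomial.eval_one, hp,
      Polynomial.eval_prod, Polynomial.eval_X, Polynomial.eval_C] at this
    exact sub_eq_zero.1 this
  have hsum : ∑ q ∈ Q', v (t - q) = 0 := by
    have : ∀ S : Finset K, v (∏ q ∈ S, (t - q)) = ∑ q ∈ S, v (t - q) := by
      intro S
      induction S using Finset.induction_on with
      | empty => simp
      | insert a S ha ih => rw [Finset.prod_insert ha, Finset.sum_insert ha, v.map_mul, ih]
    rw [← this, hprod, v.map_one]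
  have hQ0 : ∀ q ∈ Q', 0 ≤ v q := by
    intro q hq
    rcases Finset.mem_insert.1 hq with rfl | hq
    · simp
    · exact (Finset.mem_filter.1 hq).2
  have htn : 0 ≤ v t := by
    by_contra hlt
    push Not at hlt
    have h1 : ∀ q ∈ Q', v (t - q) = v t := fun q hq =>
      v.map_sub_eq_of_lt_left (hlt.trans_le (hQ0 q hq))
    rw [Finset.sum_congr rfl h1, Finset.sum_const] at hsum
    have hc : Q'.card ≠ 0 := (Finset.card_pos.2 ⟨0, h0⟩).ne'
    obtain ⟨g, hg⟩ := WithTop.ne_top_iff_exists.1 hlt.ne_top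
    rw [← hg] at hsum hlt
    have hlt' : g < 0 := by exact_mod_cast hlt
    have : Q'.card • g = 0 := by exact_mod_cast hsum
    exact absurd this (nsmul_neg hlt' hc).ne
  have hge : ∀ q ∈ Q', 0 ≤ v (t - q) := fun q hq => v.map_le_sub htn (hQ0 q hq)
  have hz := (Finset.sum_eq_zero_iff_of_nonneg hge).1 hsum
  refine ⟨t, by simpa using hz 0 h0, fun q hq => ?_⟩
  by_cases h : 0 ≤ v q
  · exact (hz q (Finset.mem_insert_of_mem (Finset.mem_filter.2 ⟨hq, h⟩))).le
  · push Not at h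
    rw [v.map_sub_eq_of_lt_right (h.trans_le htn)]
    exact h.le

theorem v_ne_zero {c : K} {γ : Γ} (hc : v c = (γ : WithTop Γ)) : c ≠ 0 := by
  rintro rfl
  rw [v.map_zero] at hc
  exact WithTop.coe_ne_top hc.symm

theorem exists_v_eq {c : K} (hc : c ≠ 0) : ∃ γ : Γ, v c = (γ : WithTop Γ) := by
  have : v c ≠ ⊤ := (v.ne_top_iff).2 hc
  obtain ⟨g, hg⟩ := WithTop.ne_top_iff_exists.1 this
  exact ⟨g, hg.symm⟩

/-- In an algebraically closed valued field the closed balls have infinitely many residue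
classes: one of them avoids a given finite set. -/
theorem exists_far [IsAlgClosed K] (hv : Function.Surjective v) (γ : Γ) (a : K) (Q : Finset K) :
    ∃ t : K, v (t - a) = (γ : WithTop Γ) ∧ ∀ q ∈ Q, v (t - q) ≤ (γ : WithTop Γ) := by
  classical
  obtain ⟨c, hc⟩ := hv (γ : WithTop Γ)
  have hc0 := v_ne_zero hc
  obtain ⟨t, ht, hQ⟩ := exists_unit_far (v := v) (Q.image fun q => (q - a) / c)
  refine ⟨a + c * t, ?_, fun q hq => ?_⟩
  · rw [add_sub_cancel_left, v.map_mul, hc, ht, add_zero]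
  · have h1 := hQ _ (Finset.mem_image_of_mem _ hq)
    have h2 : a + c * t - q = c * (t - (q - a) / c) := by field_simp; ring
    rw [h2, v.map_mul, hc]
    simpa using add_le_add_right h1 (γ : WithTop Γ)

/-- Greedy choice: avoiding the residue classes of the earlier points bounds the distances by `γ`
from above, and the common centre `a` bounds them from below. -/
theorem exists_seq_far [IsAlgClosed K] (hv : Function.Surjective v) (γ : Γ) (a : K) :
    ∃ y : ℕ → K, (∀ i, v (y i - a) = (γ : WithTop Γ)) ∧
      ∀ i j, i ≠ j → v (y i - y j) = (γ : WithTop Γ) := by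
  have : Std.Symm fun x y : K => v (x - y) = (γ : WithTop Γ) :=
    ⟨fun x y h => by rwa [v.map_sub_swap]⟩
  obtain ⟨y, h1, h2⟩ := exists_seq_of_forall_finset_exists'
    (fun x : K => v (x - a) = (γ : WithTop Γ)) (fun x y : K => v (x - y) = (γ : WithTop Γ)) (by
      intro s hs
      obtain ⟨t, ht, hQ⟩ := exists_far hv γ a s
      refine ⟨t, ht, fun x hx => le_antisymm ?_ ?_⟩
      · rw [v.map_sub_swap]; exact hQ x hx
      · exact v_le_sub_of_le (hs x hx).ge (by rw [v.map_sub_swap, ht]))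
  exact ⟨y, h1, fun i j hij => h2 hij⟩

/-- `P` supports `A`: membership of `t` in `A` depends only on the values `v (t - p)`, `p ∈ P`. -/
def IsSupport (v : AddValuation K (WithTop Γ)) (P : Finset K) (A : K → Prop) : Prop :=
  ∀ t t' : K, (∀ p ∈ P, v (t - p) = v (t' - p)) → (A t ↔ A t')

/-- Points in general position in a closed ball of radius `γ` belong together to `A`. -/
theorem IsSupport.iff_of_le {P : Finset K} {A : K → Prop} (h : IsSupport v P A) {γ : WithTop Γ}
    {t t' : K} (ht : ∀ p ∈ P, v (t - p) ≤ γ) (ht' : ∀ p ∈ P, v (t' - p) ≤ γ)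
    (htt' : γ ≤ v (t - t')) : A t ↔ A t' :=
  h t t' fun p hp => v_sub_eq_of_le (ht p hp) (ht' p hp) htt'

/-- If `y i`, `i ∈ I`, lie in distinct residue classes and `I` has more elements than `P`, then
some `y i` is in general position with respect to `P`. -/
theorem exists_general_position {γ : WithTop Γ} {y : ℕ → K}
    (hy : ∀ i j, i ≠ j → v (y i - y j) = γ) (P : Finset K) (I : Finset ℕ)
    (hI : P.card < I.card) : ∃ i ∈ I, ∀ p ∈ P, v (y i - p) ≤ γ := by
  by_contra! hcon
  choose! p hp hlt using hcon
  -- Pigeonhole: two indices share the same `p`, which puts `y i` and `y j` in one residue class.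
  obtain ⟨i, hi, j, hj, hij, he⟩ := Finset.exists_ne_map_eq_of_card_lt_of_maps_to hI hp
  have h1 := hlt i hi
  have h2 := hlt j hj
  rw [← he, v.map_sub_swap] at h2
  exact (v_lt_sub_of_lt h1 h2).ne' (hy i j hij)

end Valued

/-! ### C-minimality: germs at a point and supports of bounded size. -/

section Field

variable {L : FirstOrder.Language.{u₁, u₂}} {φ : Ldiv →ᴸ L} {K : Type w} [Field K]
    [L.Structure K] {Γ : Type w'} [AddCommGroup Γ] [LinearOrder Γ] [IsOrderedAddMonoid Γ]
    {v : AddValuation K (WithTop Γ)} {α : Type w} [Ctx K α] (T : TameField φ v)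
include T

namespace TameField

theorem symbSub_eq (x y : K) : symbSub φ K x y = x - y := by
  rw [symbSub, T.expands.map_neg, T.expands.map_add, sub_eq_add_neg]

theorem symbDiv_iff (x y : K) : symbDiv φ K x y ↔ v x ≤ v y := T.expands.map_div x y

theorem mem_closure_balls {A : K → Prop} (hA : Dfn L K A) :
    {x | A x} ∈ BooleanSubalgebra.closure (symbBalls φ K) := by
  refine T.cMinimal K rfl _ ?_
  exact Set.Definable.preimage_comp (fun _ : Unit => (0 : Fin 1)) hA

/-- Near a point, a definable set is everything or nothing. -/
theorem germ {A : K → Prop} (hA : Dfn L K A) (x : K) :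
    ∃ δ : Γ, (∀ t, t ≠ x → (δ : WithTop Γ) < v (t - x) → A t) ∨
      (∀ t, t ≠ x → (δ : WithTop Γ) < v (t - x) → ¬ A t) := by
  have key : ∀ S ∈ BooleanSubalgebra.closure (symbBalls φ K),
      ∃ δ : Γ, (∀ t, t ≠ x → (δ : WithTop Γ) < v (t - x) → t ∈ S) ∨
      (∀ t, t ≠ x → (δ : WithTop Γ) < v (t - x) → t ∉ S) := by
    intro S hS
    have hlt : ∀ t : K, t ≠ x → v (t - x) < ⊤ := fun t ht =>
      lt_top_iff_ne_top.2 ((v.ne_top_iff).2 (sub_ne_zero.2 ht))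
    -- near `x`, the values `v (t - a)` compare with `v c` always in the same way
    have cmp : ∀ a c : K, ∃ δ : Γ,
        (∀ t, t ≠ x → (δ : WithTop Γ) < v (t - x) → v c ≤ v (t - a)) ∨
        (∀ t, t ≠ x → (δ : WithTop Γ) < v (t - x) → ¬ v c ≤ v (t - a)) := by
      intro a c
      by_cases hxa : x = a
      · subst hxa
        by_cases hc : c = 0
        · exact ⟨0, Or.inr fun t ht _ => by simpa [hc] using (hlt t ht).ne⟩
        · obtain ⟨γ, hγ⟩ := exists_v_eq (v := v) hc
          exact ⟨γ, Or.inl fun t _ h => hγ ▸ h.le⟩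
      · obtain ⟨γ, hγ⟩ := exists_v_eq (v := v) (sub_ne_zero.2 hxa)
        have h1 : ∀ t, (γ : WithTop Γ) < v (t - x) → v (t - a) = (γ : WithTop Γ) := by
          intro t ht
          rw [v.map_sub_swap] at ht
          rw [v_sub_eq_of_lt (hγ.symm ▸ ht), hγ]
        by_cases hc : v c ≤ (γ : WithTop Γ)
        · exact ⟨γ, Or.inl fun t _ h => (h1 t h).symm ▸ hc⟩
        · exact ⟨γ, Or.inr fun t _ h => (h1 t h).symm ▸ hc⟩
    induction hS using BooleanSubalgebra.closure_bot_sup_induction with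
    | mem S hS =>
      rcases hS with rfl | ⟨a, c, rfl⟩ | ⟨a, c, rfl⟩
      · exact ⟨0, Or.inl fun _ _ _ => trivial⟩
      · simpa only [T.symbDiv_iff, T.symbSub_eq, Set.mem_ofPred_eq] using cmp a c
      · simp only [T.symbDiv_iff, T.symbSub_eq, Set.mem_ofPred_eq]
        by_cases hc : c = 0
        · refine ⟨0, Or.inr fun t _ _ => ?_⟩
          simp [hc]
        by_cases hxa : x = a
        · subst hxa
          obtain ⟨γ, hγ⟩ := exists_v_eq (v := v) hc
          exact ⟨γ, Or.inl fun t _ h => hγ ▸ not_le.2 h⟩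
        · obtain ⟨γ, hγ⟩ := exists_v_eq (v := v) (sub_ne_zero.2 hxa)
          have h1 : ∀ t, (γ : WithTop Γ) < v (t - x) → v (t - a) = (γ : WithTop Γ) := by
            intro t ht
            rw [v.map_sub_swap] at ht
            rw [v_sub_eq_of_lt (hγ.symm ▸ ht), hγ]
          by_cases hc : (γ : WithTop Γ) ≤ v c
          · exact ⟨γ, Or.inr fun t _ h => (h1 t h).symm ▸ not_not.2 hc⟩
          · exact ⟨γ, Or.inl fun t _ h => (h1 t h).symm ▸ hc⟩
    | bot => exact ⟨0, Or.inr fun _ _ _ h => h⟩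
    | sup S _ S' _ ih ih' =>
      obtain ⟨δ, h⟩ := ih
      obtain ⟨δ', h'⟩ := ih'
      refine ⟨max δ δ', ?_⟩
      have hδ : ∀ t, ((max δ δ' : Γ) : WithTop Γ) < v (t - x) →
          (δ : WithTop Γ) < v (t - x) ∧ (δ' : WithTop Γ) < v (t - x) := fun t ht =>
        ⟨lt_of_le_of_lt (by exact_mod_cast le_max_left _ _) ht,
          lt_of_le_of_lt (by exact_mod_cast le_max_right _ _) ht⟩
      rcases h with h | h
      · exact Or.inl fun t ht hlt => Or.inl (h t ht (hδ t hlt).1)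
      · rcases h' with h' | h'
        · exact Or.inl fun t ht hlt => Or.inr (h' t ht (hδ t hlt).2)
        · exact Or.inr fun t ht hlt hmem =>
            hmem.elim (h t ht (hδ t hlt).1) (h' t ht (hδ t hlt).2)
    | compl S _ ih =>
      obtain ⟨δ, h | h⟩ := ih
      · exact ⟨δ, Or.inr fun t ht hlt hmem => hmem (h t ht hlt)⟩
      · exact ⟨δ, Or.inl fun t ht hlt => h t ht hlt⟩
  exact key _ (T.mem_closure_balls hA)

open Filter in
/-- A definable family of subsets of `K` has supports of bounded cardinality. -/
theorem uniform_support {R : α → K → Prop} (hR : Dfn L K fun p : α × K => R p.1 p.2) :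
    ∃ N : ℕ, ∀ a, ∃ P : Finset K, P.card ≤ N ∧ IsSupport v P (R a) := by
  classical
  by_contra! hcon
  choose a ha using hcon
  obtain ⟨ψ, hψ⟩ := Set.definable_iff_exists_formula_sum.1 hR
  have hψ' : ∀ (b : α) (t : K), R b t ↔ ψ.Realize (Sum.elim (↑)
      (Sum.elim (Ctx.equiv b) fun _ => t) : (Set.univ : Set K) ⊕ (Ctx.Ix K α ⊕ Unit) → K) := by
    intro b t
    have := Set.ext_iff.1 hψ (Ctx.equiv (b, t))
    rw [Set.mem_ofPred_eq, Equiv.symm_apply_apply] at this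
    exact this
  -- Compactness through an ultrapower: `S` below is the ultraproduct of the sets `R (a n)`, where
  -- `R (a n)` has no support with at most `n` points.
  let U : Ultrafilter ℕ := hyperfilter ℕ
  let N := (U : Filter ℕ).Product fun _ => K
  let mk : (ℕ → K) → N := fun x => (x : (U : Filter ℕ).Product fun _ => K)
  have hmk : Function.Surjective mk := Quotient.mk''_surjective
  have hequiv : K ≅[L] N := by
    rw [elementarilyEquivalent_iff]
    intro σ
    rw [Ultraproduct.sentence_realize]
    simp
  let S : Set N := {t | ψ.Realize (Sum.elim (fun c : (Set.univ : Set K) => mk fun _ => c)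
    (Sum.elim (fun i => mk fun n => Ctx.equiv (a n) i) fun _ => t))}
  have hS : ∀ t : ℕ → K, mk t ∈ S ↔ ∀ᶠ n in (U : Filter ℕ), R (a n) (t n) := by
    intro t
    have h := Ultraproduct.realize_formula_cast (u := U) (M := fun _ : ℕ => K) ψ
      (Sum.elim (fun c : (Set.univ : Set K) => fun _ => (c : K))
        (Sum.elim (fun i => fun n => Ctx.equiv (a n) i) fun _ => t))
    have h2 : mk t ∈ S ↔ ψ.Realize fun i => mk (Sum.elim (fun c : (Set.univ : Set K) =>
        fun _ => (c : K)) (Sum.elim (fun i => fun n => Ctx.equiv (a n) i) fun _ => t) i) := by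
      rw [iff_eq_eq]
      refine congrArg ψ.Realize (funext fun i => ?_)
      rcases i with c | i | i <;> rfl
    rw [h2]
    refine h.trans (eventually_congr (Eventually.of_forall fun n => ?_))
    rw [hψ', iff_eq_eq]
    refine congrArg ψ.Realize (funext fun i => ?_)
    rcases i with c | i | i <;> rfl
  have hSdef : (Set.univ : Set N).Definable₁ L S := by
    refine Set.definable_iff_exists_formula_sum.2 ⟨ψ.relabel (Sum.elim
      (fun c : (Set.univ : Set K) => Sum.inl ⟨mk fun _ => c, Set.mem_univ _⟩)
      (Sum.elim (fun i => Sum.inl ⟨mk fun n => Ctx.equiv (a n) i, Set.mem_univ _⟩)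
        fun _ => Sum.inr 0)), ?_⟩
    ext x
    refine Iff.trans ?_ Formula.realize_relabel.symm
    refine iff_of_eq (congrArg ψ.Realize (funext fun i => ?_))
    rcases i with c | i | i <;> rfl
  have hdiv : ∀ x y : ℕ → K, symbDiv φ N (mk x) (mk y) ↔
      ∀ᶠ n in (U : Filter ℕ), v (x n) ≤ v (y n) := by
    intro x y
    have h := Ultraproduct.realize_formula_cast (u := U) (M := fun _ : ℕ => K)
      ((φ.onRelation Ldiv.divSymb).formula₂ (Term.var (0 : Fin 2)) (Term.var 1)) ![x, y]
    simpa [Formula.realize_rel₂, T.expands.map_div] using! h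
  have hfun₁ : ∀ (g : L.Functions 1) (x : ℕ → K),
      funMap g ![mk x] = mk fun n => funMap g ![x n] := by
    intro g x
    have h := Ultraproduct.funMap_cast (u := U) (M := fun _ : ℕ => K) g ![x]
    refine (congrArg (funMap g) (funext fun i => ?_)).trans (h.trans (congrArg mk (funext fun n =>
      congrArg (funMap g) (funext fun i => ?_))))
    · fin_cases i; rfl
    · fin_cases i; rfl
  have hfun₂ : ∀ (g : L.Functions 2) (x y : ℕ → K),
      funMap g ![mk x, mk y] = mk fun n => funMap g ![x n, y n] := by
    intro g x y
    have h := Ultraproduct.funMap_cast (u := U) (M := fun _ : ℕ => K) g ![x, y]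
    refine (congrArg (funMap g) (funext fun i => ?_)).trans (h.trans (congrArg mk (funext fun n =>
      congrArg (funMap g) (funext fun i => ?_))))
    · fin_cases i <;> rfl
    · fin_cases i <;> rfl
  have hsub : ∀ x y : ℕ → K, symbSub φ N (mk x) (mk y) = mk fun n => x n - y n := by
    intro x y
    rw [symbSub, hfun₁, hfun₂]
    simp only [T.expands.map_neg, T.expands.map_add, sub_eq_add_neg]
  -- In the ultrapower `S` is a combination of finitely many balls; sequences representing their
  -- centres support `S`, distances being compared coordinatewise almost everywhere.
  have hsupp : ∃ P : Finset (ℕ → K), ∀ t t' : ℕ → K,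
      (∀ p ∈ P, ∀ᶠ n in (U : Filter ℕ), v (t n - p n) = v (t' n - p n)) →
        (mk t ∈ S ↔ mk t' ∈ S) := by
    have hcl := T.cMinimal N hequiv S hSdef
    clear_value S
    clear hS hSdef
    induction hcl using BooleanSubalgebra.closure_bot_sup_induction with
    | mem S hS =>
      rcases hS with rfl | ⟨b, c, rfl⟩ | ⟨b, c, rfl⟩
      · exact ⟨∅, fun _ _ _ => Iff.rfl⟩
      · obtain ⟨b, rfl⟩ := hmk b
        obtain ⟨c, rfl⟩ := hmk c
        refine ⟨{b}, fun t t' h => ?_⟩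
        simp only [Set.mem_ofPred_eq, hsub, hdiv]
        exact eventually_congr ((h b (by simp)).mono fun n hn => by rw [hn])
      · obtain ⟨b, rfl⟩ := hmk b
        obtain ⟨c, rfl⟩ := hmk c
        refine ⟨{b}, fun t t' h => ?_⟩
        simp only [Set.mem_ofPred_eq, hsub, hdiv]
        exact not_congr (eventually_congr ((h b (by simp)).mono fun n hn => by rw [hn]))
    | bot => exact ⟨∅, fun _ _ _ => Iff.rfl⟩
    | sup S _ S' _ ih ih' =>
      obtain ⟨P, h⟩ := ih
      obtain ⟨P', h'⟩ := ih'
      refine ⟨P ∪ P', fun t t' ht => ?_⟩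
      exact or_congr (h t t' fun p hp => ht p (Finset.mem_union_left _ hp))
        (h' t t' fun p hp => ht p (Finset.mem_union_right _ hp))
    | compl S _ ih =>
      obtain ⟨P, h⟩ := ih
      exact ⟨P, fun t t' ht => not_congr (h t t' ht)⟩
  obtain ⟨P, hP⟩ := hsupp
  have hbad : ∀ᶠ n in (U : Filter ℕ), ¬ IsSupport v (P.image fun p => p n) (R (a n)) := by
    have : ∀ᶠ n in (U : Filter ℕ), P.card ≤ n :=
      (Filter.eventually_ge_atTop P.card).filter_mono
        ((hyperfilter_le_cofinite).trans Nat.cofinite_eq_atTop.le)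
    exact this.mono fun n hn => ha n _ (Finset.card_image_le.trans hn)
  -- The counterexamples in the coordinates glue to two elements with the same distances to the
  -- centres, which `S` would nevertheless have to separate.
  have hwit : ∀ n, ∃ t t' : K, ¬ IsSupport v (P.image fun p => p n) (R (a n)) →
      (∀ p ∈ P, v (t - p n) = v (t' - p n)) ∧ ¬ (R (a n) t ↔ R (a n) t') := by
    intro n
    by_cases h : IsSupport v (P.image fun p => p n) (R (a n))
    · exact ⟨0, 0, fun h' => absurd h h'⟩
    · have h' := h
      unfold IsSupport at h'
      push Not at h'
      obtain ⟨t, t', h1, h2⟩ := h'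
      refine ⟨t, t', fun _ => ⟨fun p hp => h1 _ (Finset.mem_image_of_mem _ hp), ?_⟩⟩
      tauto
  choose t t' ht using hwit
  have h1 := hP t t' fun p hp => hbad.mono fun n hn => (ht n hn).1 p hp
  rw [hS, hS] at h1
  have h2 : ∀ᶠ n in (U : Filter ℕ), ¬ (R (a n) (t n) ↔ R (a n) (t' n)) :=
    hbad.mono fun n hn => (ht n hn).2
  rcases U.em (fun n => R (a n) (t n)) with h3 | h3
  · obtain ⟨n, hn1, hn2, hn3⟩ := (h3.and ((h1.1 h3).and h2)).exists
    exact hn3 ⟨fun _ => hn2, fun _ => hn1⟩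
  · have h4 : ∀ᶠ n in (U : Filter ℕ), ¬ R (a n) (t' n) := by
      rw [Ultrafilter.eventually_not] at h3 ⊢
      exact fun h => h3 (h1.2 h)
    obtain ⟨n, hn1, hn2, hn3⟩ := (h3.and (h4.and h2)).exists
    exact hn3 ⟨fun h => absurd h hn1, fun h => absurd h hn2⟩

end TameField

end Field

/-! ### Balls in definable sets and definable total preorders. -/

section Field

variable {L : FirstOrder.Language.{u₁, u₂}} {φ : Ldiv →ᴸ L} {K : Type w} [Field K]
    [L.Structure K] {Γ : Type w'} [AddCommGroup Γ] [LinearOrder Γ] [IsOrderedAddMonoid Γ]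
    {v : AddValuation K (WithTop Γ)} {α : Type w} [Ctx K α]

/-- A point outside the support of a set lies in the set together with a ball. -/
theorem IsSupport.exists_ball {P : Finset K} {A : K → Prop} (h : IsSupport v P A) {x : K}
    (hx : x ∉ P) : ∃ γ : Γ, ∀ y, (γ : WithTop Γ) < v (y - x) → (A y ↔ A x) := by
  obtain ⟨γ, hγ⟩ : ∃ γ : Γ, ∀ p ∈ P, v (x - p) ≤ (γ : WithTop Γ) := by
    classical
    clear h
    induction P using Finset.induction_on with
    | empty => exact ⟨0, by simp⟩
    | insert p P _ ih =>
      simp only [Finset.mem_insert, not_or] at hx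
      obtain ⟨γ, hγ⟩ := ih hx.2
      obtain ⟨δ, hδ⟩ := exists_v_eq (v := v) (sub_ne_zero.2 hx.1)
      refine ⟨max γ δ, fun q hq => ?_⟩
      rcases Finset.mem_insert.1 hq with rfl | hq
      · rw [hδ]; exact_mod_cast le_max_right _ _
      · exact (hγ q hq).trans (by exact_mod_cast le_max_left _ _)
  refine ⟨γ, fun y hy => h y x fun p hp => ?_⟩
  rw [v.map_sub_swap] at hy
  exact v_sub_eq_of_lt ((hγ p hp).trans_lt hy)

variable (T : TameField φ v)
include T

namespace TameField

theorem exists_support {A : K → Prop} (hA : Dfn L K A) : ∃ P : Finset K, IsSupport v P A := by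
  obtain ⟨N, hN⟩ := T.uniform_support (R := fun _ : K => A) (hA.comp (DMap.snd DMap.id))
  obtain ⟨P, -, hP⟩ := hN 0
  exact ⟨P, hP⟩

/-- An infinite definable set contains a ball. -/
theorem exists_ball_of_infinite {A : K → Prop} (hA : Dfn L K A) (hinf : {x | A x}.Infinite) :
    ∃ x, A x ∧ ∃ γ : Γ, ∀ y, (γ : WithTop Γ) < v (y - x) → A y := by
  obtain ⟨P, hP⟩ := T.exists_support hA
  obtain ⟨x, hx, hxP⟩ := hinf.exists_notMem_finset P
  obtain ⟨γ, hγ⟩ := hP.exists_ball hxP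
  exact ⟨x, hx, γ, fun y hy => (hγ y hy).2 hx⟩

/-- For a definable total preorder on `K`, infinitely many points of a given sequence of points in
distinct residue classes are equivalent. -/
theorem preorder_seq {R : K → K → Prop} (hR : Dfn L K fun p : K × K => R p.1 p.2)
    (htot : ∀ x y, R x y ∨ R y x) (htrans : ∀ x y z, R x y → R y z → R x z) {γ : WithTop Γ}
    {y : ℕ → K} (hy : ∀ i j, i ≠ j → v (y i - y j) = γ) :
    ∃ i, {j | R (y i) (y j) ∧ R (y j) (y i)}.Infinite := by
  have hne : ∀ (g : ℕ ↪o ℕ) (i j : ℕ), i ≠ j → v (y (g i) - y (g j)) = γ := fun g i j hij =>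
    hy _ _ fun h => hij (g.injective h)
  obtain ⟨N, hN⟩ := T.uniform_support (R := fun x t : K => R t x)
    (hR.comp₂ (DMap.snd DMap.id) (DMap.fst DMap.id))
  -- no initial segment separates `N + 1` of the points from `N + 1` others
  have sep : ∀ z : ℕ → K, (∀ i j, i ≠ j → v (z i - z j) = γ) → ∀ (x : K) (I J : Finset ℕ),
      N < I.card → N < J.card → (∀ i ∈ I, R (z i) x) → (∀ j ∈ J, ¬ R (z j) x) → Disjoint I J →
      False := by
    intro z hz x I J hI hJ hIR hJR hd
    obtain ⟨P, hPN, hP⟩ := hN x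
    obtain ⟨i, hi, hi'⟩ := exists_general_position hz P I (hPN.trans_lt hI)
    obtain ⟨j, hj, hj'⟩ := exists_general_position hz P J (hPN.trans_lt hJ)
    have hij : i ≠ j := fun h => Finset.disjoint_left.1 hd hi (h ▸ hj)
    exact hJR j hj ((hP.iff_of_le hi' hj' (hz i j hij).ge).1 (hIR i hi))
  have hdisj : Disjoint (Finset.range (N + 1)) (Finset.Ico (N + 1) (2 * N + 2)) := by
    rw [Finset.disjoint_left]
    intro i hi hj
    rw [Finset.mem_range] at hi
    rw [Finset.mem_Ico] at hj
    omega
  have hrefl : ∀ x, R x x := fun x => (htot x x).elim id id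
  -- Ramsey: some subsequence is strictly increasing, strictly decreasing or made of equivalent
  -- points. In the strict cases the initial segment cut at a middle term has `N + 1` points on each
  -- side, against `sep`.
  obtain ⟨g, hg | hg⟩ := exists_increasing_or_nonincreasing_subseq' (fun a b => ¬ R b a) y
  · -- strictly increasing
    exfalso
    have hinc : ∀ i j, i < j → ¬ R (y (g j)) (y (g i)) := by
      intro i j hij
      induction j, hij using Nat.le_induction with
      | base => exact hg i
      | succ j hij ih =>
        intro h
        rcases htot (y (g j)) (y (g i)) with h' | h'
        · exact ih h'
        · exact hg j (htrans _ _ _ h h')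
    refine sep (fun i => y (g i)) (hne g) (y (g N)) _ _ ?_ ?_ ?_ ?_ hdisj
    · simp
    · simp; omega
    · intro i hi
      rcases (Nat.lt_succ_iff.1 (Finset.mem_range.1 hi)).lt_or_eq with h | h
      · exact (htot _ _).resolve_right (hinc i N h)
      · rw [h]; exact hrefl _
    · intro j hj
      exact hinc N j (Finset.mem_Ico.1 hj).1
  · push Not at hg
    obtain ⟨g', hg' | hg'⟩ :=
      exists_increasing_or_nonincreasing_subseq' (fun a b => ¬ R a b) fun i => y (g i)
    · exfalso
      have hdec : ∀ i j, i < j → ¬ R (y (g (g' i))) (y (g (g' j))) := by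
        intro i j hij
        induction j, hij using Nat.le_induction with
        | base => exact hg' i
        | succ j hij ih =>
          intro h
          rcases htot (y (g (g' i))) (y (g (g' j))) with h' | h'
          · exact ih h'
          · exact hg' j (htrans _ _ _ h' h)
      refine sep (fun i => y (g (g' i))) (fun i j hij => hne g _ _ fun h => hij (g'.injective h))
        (y (g (g' (N + 1)))) _ _ ?_ ?_ ?_ ?_ hdisj.symm
      · simp; omega
      · simp
      · intro i hi
        rcases (Finset.mem_Ico.1 hi).1.lt_or_eq with h | h
        · exact (htot _ _).resolve_right (hdec _ _ h)
        · rw [← h]; exact hrefl _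
      · intro j hj
        exact hdec j _ (Finset.mem_range.1 hj)
    · push Not at hg'
      refine ⟨g (g' 0), Set.infinite_of_injective_forall_mem (f := fun n => g (g' (n + 1)))
        (fun a b h => by simpa using h) fun n => ⟨hg' 0 (n + 1) (by omega), ?_⟩⟩
      exact hg (g' 0) (g' (n + 1)) (by simp)

/-- For a definable total preorder on `K`, every ball contains a ball all of whose points are
equivalent. -/
theorem preorder_ball [IsAlgClosed K] [Nontrivial Γ] {R : K → K → Prop}
    (hR : Dfn L K fun p : K × K => R p.1 p.2)
    (htot : ∀ x y, R x y ∨ R y x) (htrans : ∀ x y z, R x y → R y z → R x z) (a : K) (γ : Γ) :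
    ∃ b : K, (γ : WithTop Γ) < v (b - a) ∧ ∃ δ : Γ, γ ≤ δ ∧
      ∀ x y, (δ : WithTop Γ) < v (x - b) → (δ : WithTop Γ) < v (y - b) → R x y := by
  obtain ⟨γ', hγ'⟩ := exists_gt γ
  obtain ⟨y, hya, hy⟩ := exists_seq_far T.surj γ' a
  obtain ⟨i, hi⟩ := T.preorder_seq hR htot htrans hy
  have hyinj : Function.Injective y := by
    intro i j hij
    by_contra hne
    have := hy i j hne
    rw [hij, sub_self, v.map_zero] at this
    exact WithTop.coe_ne_top this.symm
  have hdef : Dfn L K fun x : K => ((γ : WithTop Γ) < v (x - a)) ∧ R (y i) x ∧ R x (y i) := by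
    refine (T.const_lt_v (T.sub DMap.id (DMap.const a)) _).and
      ((hR.comp₂ (DMap.const _) DMap.id).and (hR.comp₂ DMap.id (DMap.const _)))
  -- The class of `y i` has infinitely many points in the given ball, so it contains a ball.
  obtain ⟨b, ⟨hb, -, -⟩, δ, hδ⟩ := T.exists_ball_of_infinite hdef (by
    refine (hi.image hyinj.injOn).mono ?_
    rintro _ ⟨j, ⟨h1, h2⟩, rfl⟩
    exact ⟨by rw [hya]; exact_mod_cast hγ', h1, h2⟩)
  refine ⟨b, hb, max γ δ, le_max_left _ _, fun x y hx hy => ?_⟩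
  have hm : (δ : WithTop Γ) ≤ ((max γ δ : Γ) : WithTop Γ) := by exact_mod_cast le_max_right _ _
  exact htrans _ _ _ (hδ x (hm.trans_lt hx)).2.2 (hδ y (hm.trans_lt hy)).2.1

end TameField

end Field

/-! ### Definable functions into the value group. -/

section Field

variable {L : FirstOrder.Language.{u₁, u₂}} {φ : Ldiv →ᴸ L} {K : Type w} [Field K]
    [L.Structure K] {Γ : Type w'} [AddCommGroup Γ] [LinearOrder Γ] [IsOrderedAddMonoid Γ]
    {v : AddValuation K (WithTop Γ)} {α : Type w} [Ctx K α]

-- A rational slope other than `0` is incompatible with bounds on arbitrarily large arguments;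
-- denominators cancel since an ordered group is torsion-free.
omit [L.Structure K] in
theorem EventuallyQLinear.eventually_const [Nontrivial Γ] {g : Γ → Γ} (hg : EventuallyQLinear g)
    {β σ δ₀ : Γ} (hb : ∀ γ, δ₀ < γ → β ≤ g γ ∧ g γ ≤ σ) :
    ∃ κ δ : Γ, ∀ γ, δ < γ → g γ = κ := by
  obtain ⟨δ, α, r, h⟩ := hg
  have hden : 0 < r.den := r.den_pos
  have key : ∀ γ, max δ δ₀ < γ → r.den • (β - α) ≤ r.num • γ ∧ r.num • γ ≤ r.den • (σ - α) := by
    intro γ hγ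
    rw [← h γ ((le_max_left _ _).trans_lt hγ)]
    obtain ⟨h1, h2⟩ := hb γ ((le_max_right _ _).trans_lt hγ)
    exact ⟨nsmul_le_nsmul_right (sub_le_sub_right h1 _) _,
      nsmul_le_nsmul_right (sub_le_sub_right h2 _) _⟩
  have hr : r.num = 0 := by
    -- take `γ` larger than `|r.den • (β - α)|`, `|r.den • (σ - α)|`
    set C := max (max δ δ₀) (max |r.den • (β - α)| |r.den • (σ - α)|) with hC
    obtain ⟨γ, hγ⟩ := exists_gt C
    obtain ⟨k1, k2⟩ := key γ ((le_max_left _ _).trans_lt hγ)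
    have h1 : |r.den • (β - α)| < γ :=
      ((le_max_left _ _).trans (le_max_right _ _)).trans_lt hγ
    have h2 : |r.den • (σ - α)| < γ :=
      ((le_max_right _ _).trans (le_max_right _ _)).trans_lt hγ
    have hpos : 0 < γ := (abs_nonneg _).trans_lt h1
    rcases lt_trichotomy r.num 0 with hn | hn | hn
    · exfalso
      have : r.num • γ ≤ (-1 : ℤ) • γ := zsmul_le_zsmul_left hpos.le (by omega)
      rw [neg_one_zsmul] at this
      exact absurd (k1.trans this) (not_le.2 (abs_lt.1 h1).1)
    · exact hn
    · exfalso
      have : (1 : ℤ) • γ ≤ r.num • γ := zsmul_le_zsmul_left hpos.le (by omega)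
      rw [one_zsmul] at this
      exact absurd (this.trans k2) (not_le.2 (abs_lt.1 h2).2)
  refine ⟨α, δ, fun γ hγ => ?_⟩
  have := h γ hγ
  rw [hr, zero_zsmul] at this
  exact sub_eq_zero.1 ((nsmul_eq_zero_iff_right hden.ne').1 this)

variable (T : TameField φ v)
include T

namespace TameField

-- Functions to the value group are coded by their hypographs `v c ≤ H b`; since `v` is surjective,
-- order and equality of their values can be recovered by quantifying over `c`.
omit T in
theorem dfn_v_le {H : K → WithTop Γ} (hH : Dfn L K fun p : K × K => v p.2 ≤ H p.1)
    {s t : α → K} (hs : DMap L K s) (ht : DMap L K t) : Dfn L K fun a => v (t a) ≤ H (s a) :=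
  hH.comp₂ (R := fun b c => v c ≤ H b) hs ht

theorem dfn_le {H : K → WithTop Γ} (hH : Dfn L K fun p : K × K => v p.2 ≤ H p.1)
    {s t : α → K} (hs : DMap L K s) (ht : DMap L K t) : Dfn L K fun a => H (s a) ≤ H (t a) := by
  have : ∀ a, H (s a) ≤ H (t a) ↔ ∀ c : K, v c ≤ H (s a) → v c ≤ H (t a) := fun a =>
    ⟨fun h c hc => hc.trans h, fun h => by
      obtain ⟨c, hc⟩ := T.surj (H (s a))
      exact hc ▸ h c hc.le⟩
  simp only [this]
  exact Dfn.all ((dfn_v_le hH (hs.comp (DMap.fst DMap.id)) (DMap.snd DMap.id)).imp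
    (dfn_v_le hH (ht.comp (DMap.fst DMap.id)) (DMap.snd DMap.id)))

theorem dfn_eq {H : K → WithTop Γ} (hH : Dfn L K fun p : K × K => v p.2 ≤ H p.1)
    {s t : α → K} (hs : DMap L K s) (ht : DMap L K t) : Dfn L K fun a => H (s a) = v (t a) := by
  have : ∀ a, H (s a) = v (t a) ↔ v (t a) ≤ H (s a) ∧ ∀ c : K, v c ≤ H (s a) → v c ≤ v (t a) :=
    fun a => ⟨fun h => ⟨h.ge, fun c hc => hc.trans h.le⟩, fun h => by
      obtain ⟨c, hc⟩ := T.surj (H (s a))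
      exact le_antisymm (hc ▸ h.2 c hc.le) h.1⟩
  simp only [this]
  exact (dfn_v_le hH hs ht).and (Dfn.all
    ((dfn_v_le hH (hs.comp (DMap.fst DMap.id)) (DMap.snd DMap.id)).imp
      (T.v_le (DMap.snd DMap.id) (ht.comp (DMap.fst DMap.id)))))

theorem dfn_eq_const {H : K → WithTop Γ} (hH : Dfn L K fun p : K × K => v p.2 ≤ H p.1)
    (η : WithTop Γ) : Dfn L K fun b => H b = η := by
  obtain ⟨d, rfl⟩ := T.surj η
  exact T.dfn_eq hH DMap.id (DMap.const d)

/-- `Y` contains almost all residue classes of the sphere of radius `γ`. -/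
def _root_.IsLargeOnSphere (v : AddValuation K (WithTop Γ)) (γ : WithTop Γ) (Y : K → Prop) : Prop :=
  ∀ s : K, v s = 0 → ∃ b, (v b = γ ∧ Y b) ∧ (v (s * b) = γ ∧ Y (s * b))

/-- Comparing values of `H` is a total preorder, so one value is taken in infinitely many residue
classes of the sphere. One of these points is in general position for a support of that level set,
so every point of the sphere in general position has the same value. -/
theorem exists_isLargeOnSphere [IsAlgClosed K] {H : K → WithTop Γ}
    (hH : Dfn L K fun p : K × K => v p.2 ≤ H p.1) (γ : Γ) :
    ∃ c : K, v c = (γ : WithTop Γ) ∧ IsLargeOnSphere v γ fun b => H b = H c := by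
  classical
  obtain ⟨y, hy0, hy⟩ := exists_seq_far T.surj γ 0
  obtain ⟨i, hi⟩ := T.preorder_seq (R := fun x y => H x ≤ H y)
    (T.dfn_le hH (DMap.fst DMap.id) (DMap.snd DMap.id)) (fun x y => le_total _ _)
    (fun x y z => le_trans) hy
  simp only [sub_zero] at hy0
  refine ⟨y i, hy0 i, ?_⟩
  obtain ⟨P, hP⟩ := T.exists_support (T.dfn_eq_const hH _)
  obtain ⟨I, hI, hIc⟩ := hi.exists_subset_card_eq (P.card + 1)
  obtain ⟨j, hj, hjP⟩ := exists_general_position hy P I (by omega)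
  have hYj : H (y j) = H (y i) := by
    have := hI hj
    exact le_antisymm this.2 this.1
  have hgen : ∀ b : K, v b = γ → (∀ p ∈ P, v (b - p) ≤ γ) → H b = H (y i) := by
    intro b hb hbP
    refine (hP.iff_of_le hbP hjP ?_).2 hYj
    exact v.map_le_sub hb.ge (hy0 j).ge
  intro s hs
  have hs0 : s ≠ 0 := by
    rintro rfl
    simp at hs
  -- Avoiding both `P` and `P / s` puts `b` and `s * b` in general position with respect to `P`.
  obtain ⟨b, hb, hbP⟩ := exists_far T.surj γ 0 (P ∪ P.image fun p => p / s)
  rw [sub_zero] at hb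
  have hsb : v (s * b) = γ := by rw [v.map_mul, hs, zero_add, hb]
  refine ⟨b, ⟨hb, hgen b hb fun p hp => hbP p (Finset.mem_union_left _ hp)⟩, hsb,
    hgen _ hsb fun p hp => ?_⟩
  have := hbP (p / s) (Finset.mem_union_right _ (Finset.mem_image_of_mem _ hp))
  have e : s * b - p = s * (b - p / s) := by field_simp
  rwa [e, v.map_mul, hs, zero_add]

-- If `Y` met only the residue classes of `Q`, choose a unit `s` in no residue class of a ratio `q'
-- / q`. For `b` and `s * b` in `Y`, in the classes of `q` and `q'`, this `s` would be in the class
-- of `q' / q`.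
omit T [L.Structure K] in
theorem _root_.IsLargeOnSphere.exists_far [IsAlgClosed K] {γ : Γ} {Y : K → Prop}
    (hY : IsLargeOnSphere v γ Y) (Q : Finset K) :
    ∃ b, v b = γ ∧ Y b ∧ ∀ q ∈ Q, v (b - q) ≤ γ := by
  classical
  by_contra! hcon
  obtain ⟨s, hs, hsQ⟩ := exists_unit_far (v := v) ((Q ×ˢ Q).image fun q => q.2 / q.1)
  obtain ⟨b, ⟨hb, hYb⟩, hsb, hYsb⟩ := hY s hs
  obtain ⟨q, hq, h1⟩ := hcon b hb hYb
  obtain ⟨q', hq', h2⟩ := hcon _ hsb hYsb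
  have hvq : v q = γ := by
    have e : q = b - (b - q) := by ring
    rw [e, v.map_sub_eq_of_lt_left (hb ▸ h1), hb]
  have hq0 := v_ne_zero hvq
  have h3 := hsQ _ (Finset.mem_image_of_mem _ (Finset.mk_mem_product hq hq'))
  have e : q * (s - q' / q) = (s * b - q') - s * (b - q) := by field_simp; ring
  have h4 : (γ : WithTop Γ) < v (q * (s - q' / q)) := by
    rw [e, sub_eq_add_neg]
    refine v.map_lt_add h2 ?_
    rwa [v.map_neg, v.map_mul, hs, zero_add]
  rw [v.map_mul, hvq] at h4
  exact absurd h4 (not_lt.2 (by simpa using add_le_add_right h3 (γ : WithTop Γ)))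

/-- Both level sets contain points in general position for a support of the first one, and such
points are not separated by it. -/
theorem isLargeOnSphere_unique [IsAlgClosed K] {H : K → WithTop Γ}
    (hH : Dfn L K fun p : K × K => v p.2 ≤ H p.1) {γ : Γ} {η η' : WithTop Γ}
    (h : IsLargeOnSphere v γ fun b => H b = η) (h' : IsLargeOnSphere v γ fun b => H b = η') :
    η = η' := by
  classical
  obtain ⟨P, hP⟩ := T.exists_support (T.dfn_eq_const hH η)
  obtain ⟨b, hb, hYb, hbP⟩ := h.exists_far P
  obtain ⟨b', hb', hYb', hbP'⟩ := h'.exists_far P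
  have := (hP.iff_of_le hbP hbP' (v.map_le_sub hb.ge hb'.ge)).1 hYb
  exact this.symm.trans hYb'

/-- A definable function to the value group which is bounded near `0` is constant near `0`. -/
theorem eventually_const [IsAlgClosed K] [Nontrivial Γ] {H : K → WithTop Γ}
    (hH : Dfn L K fun p : K × K => v p.2 ≤ H p.1) {β σ δ₀ : Γ}
    (hb : ∀ b, b ≠ 0 → (δ₀ : WithTop Γ) < v b → β ≤ H b ∧ H b ≤ σ) :
    ∃ κ δ : Γ, ∀ b, b ≠ 0 → (δ : WithTop Γ) < v b → H b = κ := by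
  classical
  -- The generic value of `H` on the sphere of radius `γ` defines a function on the value group; `0`
  -- is a default where no bound is available.
  have hex : ∀ γ : Γ, ∃ η : Γ, (δ₀ < γ → IsLargeOnSphere v γ fun b => H b = η) ∧
      (¬ δ₀ < γ → η = 0) := by
    intro γ
    by_cases hγ : δ₀ < γ
    · obtain ⟨c, hc, hl⟩ := T.exists_isLargeOnSphere hH γ
      have hle := (hb c (v_ne_zero hc) (by rw [hc]; exact_mod_cast hγ)).2
      obtain ⟨η, hη⟩ := WithTop.ne_top_iff_exists.1 (hle.trans_lt (WithTop.coe_lt_top σ)).ne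
      exact ⟨η, fun _ => hη ▸ hl, fun h => absurd hγ h⟩
    · exact ⟨0, fun h => absurd h hγ, fun _ => rfl⟩
  choose g hg hg0 using hex
  have hgdef : IsDefinableGammaFun v L g := by
    have key : ∀ p : K × K, (∃ γ : Γ, v p.1 = (γ : WithTop Γ) ∧ v p.2 = (g γ : WithTop Γ)) ↔
        (¬ p.1 = 0) ∧ (¬ p.2 = 0) ∧ (((δ₀ : WithTop Γ) < v p.1 ∧ ∀ s : K, v s = 0 →
          ∃ b, (v b = v p.1 ∧ H b = v p.2) ∧ (v (s * b) = v p.1 ∧ H (s * b) = v p.2)) ∨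
          (¬ (δ₀ : WithTop Γ) < v p.1 ∧ v p.2 = 0)) := by
      rintro ⟨x, z⟩
      constructor
      · rintro ⟨γ, h1, h2⟩
        refine ⟨v_ne_zero h1, v_ne_zero h2, ?_⟩
        simp only at h1 h2 ⊢
        rw [h1, h2, WithTop.coe_lt_coe]
        by_cases hγ : δ₀ < γ
        · exact Or.inl ⟨hγ, hg γ hγ⟩
        · exact Or.inr ⟨hγ, by rw [hg0 γ hγ]; rfl⟩
      · rintro ⟨h1, h2, h3⟩
        obtain ⟨γ, hγ⟩ := exists_v_eq (v := v) h1
        refine ⟨γ, hγ, ?_⟩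
        simp only at h3 hγ ⊢
        rw [hγ, WithTop.coe_lt_coe] at h3
        rcases h3 with ⟨h3, h4⟩ | ⟨h3, h4⟩
        · exact T.isLargeOnSphere_unique hH (γ := γ) h4 (hg γ h3)
        · rw [h4, hg0 γ h3]; rfl
    have hdef : Dfn L K fun p : K × K =>
        ∃ γ : Γ, v p.1 = (γ : WithTop Γ) ∧ v p.2 = (g γ : WithTop Γ) := by
      simp only [key]
      with_reducible repeat' first
          | apply DMap.id | apply DMap.const | apply DMap.fst | apply DMap.snd | apply Dfn.and
          | apply Dfn.or | apply Dfn.not | apply Dfn.imp | apply Dfn.ex | apply Dfn.all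
          | apply T.v_lt | apply T.v_eq | apply T.const_lt_v | apply T.v_eq_const
          | apply T.dfn_eq hH | apply DMap.eq | apply T.mul
    exact Set.Definable.preimage_comp (Sum.elim (fun _ : Unit => (0 : Fin 2)) fun _ : Unit => 1)
      hdef
  obtain ⟨κ, δ, hκ⟩ := (T.qLinear g hgdef).eventually_const (β := β) (σ := σ) (δ₀ := δ₀) (by
    intro γ hγ
    obtain ⟨b, ⟨hb1, hb2⟩, -⟩ := hg γ hγ 1 v.map_one
    have := hb b (v_ne_zero hb1) (by rw [hb1]; exact_mod_cast hγ)
    rw [hb2] at this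
    exact_mod_cast this)
  -- The generic value `κ` is attained on all small spheres, so the level set of `κ` cannot be empty
  -- near `0`; being all or nothing there, it is everything.
  obtain ⟨δ₁, h1 | h1⟩ := T.germ (T.dfn_eq_const hH κ) 0
  · exact ⟨κ, δ₁, fun b hb0 hb1 => h1 b hb0 (by rwa [sub_zero])⟩
  · exfalso
    obtain ⟨γ, hγ⟩ := exists_gt (max δ₁ (max δ δ₀))
    obtain ⟨b, ⟨hb1, hb2⟩, -⟩ := hg γ
      (((le_max_right _ _).trans (le_max_right _ _)).trans_lt hγ) 1 v.map_one
    rw [hκ γ (((le_max_left _ _).trans (le_max_right _ _)).trans_lt hγ)] at hb2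
    refine h1 b (v_ne_zero hb1) ?_ hb2
    rw [sub_zero, hb1]
    exact_mod_cast (le_max_left _ _).trans_lt hγ

end TameField

end Field

/-! ### Limits at `0` and residue classes of values of definable functions. -/

section Field

variable {L : FirstOrder.Language.{u₁, u₂}} {φ : Ldiv →ᴸ L} {K : Type w} [Field K]
    [L.Structure K] {Γ : Type w'} [AddCommGroup Γ] [LinearOrder Γ] [IsOrderedAddMonoid Γ]
    {v : AddValuation K (WithTop Γ)} {α : Type w} [Ctx K α]

theorem mem_openBall_coe {a x : K} {γ : Γ} :
    x ∈ openBall v a (γ : WithBot Γ) ↔ (γ : WithTop Γ) < v (x - a) := by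
  simp [openBall]

omit [AddCommGroup Γ] [IsOrderedAddMonoid Γ] in
theorem coe_le_max_left (γ δ : Γ) : (γ : WithTop Γ) ≤ ((max γ δ : Γ) : WithTop Γ) := by
  exact_mod_cast le_max_left _ _

omit [AddCommGroup Γ] [IsOrderedAddMonoid Γ] in
theorem coe_le_max_right (γ δ : Γ) : (δ : WithTop Γ) ≤ ((max γ δ : Γ) : WithTop Γ) := by
  exact_mod_cast le_max_right _ _

variable (T : TameField φ v)
include T

namespace TameField

theorem exists_near [Nontrivial Γ] (γ : Γ) : ∃ b : K, b ≠ 0 ∧ (γ : WithTop Γ) < v b := by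
  obtain ⟨δ, hδ⟩ := exists_gt γ
  obtain ⟨b, hb⟩ := T.surj δ
  exact ⟨b, v_ne_zero hb, by rw [hb]; exact_mod_cast hδ⟩

/-- If the differences of the values of `h` near `0` are generically of the same value `κ`, then
`h` cannot be definable: the sets of values of `h` on shrinking neighbourhoods of `0` would omit
more and more residue classes. -/
theorem not_generic_differences [Nontrivial Γ] {h : K → K} (hh : DMap L K h) (κ δ₂ : Γ)
    (D : K → Γ) (hD : ∀ a, a ≠ 0 → (δ₂ : WithTop Γ) < v a → ∀ b, b ≠ 0 →
      (D a : WithTop Γ) < v b → v (h a - h b) = κ) : False := by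
  classical
  have hdef : Dfn L K fun p : K × K =>
      ∃ b : K, (¬ b = 0) ∧ v p.1 < v b ∧ (κ : WithTop Γ) < v (h b - p.2) := by
    with_reducible repeat' first
        | apply DMap.id | apply DMap.const | apply DMap.fst | apply DMap.snd | apply Dfn.and
        | apply Dfn.not | apply Dfn.ex | apply T.v_lt | apply T.const_lt_v | apply DMap.eq
        | apply T.sub | apply hh.comp
  obtain ⟨N, hN⟩ := T.uniform_support
    (R := fun d z : K => ∃ b : K, (¬ b = 0) ∧ v d < v b ∧ (κ : WithTop Γ) < v (h b - z)) hdef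
  have hseq : ∀ δ : Γ, δ₂ ≤ δ → ∃ y : ℕ → K, (∀ i, y i ≠ 0 ∧ (δ : WithTop Γ) < v (y i)) ∧
      ∀ i j, i ≠ j → v (h (y i) - h (y j)) = κ := by
    intro δ hδ
    have : Std.Symm fun x y : K => v (h x - h y) = κ := ⟨fun x y h => by rwa [v.map_sub_swap]⟩
    obtain ⟨y, h1, h2⟩ := exists_seq_of_forall_finset_exists'
      (fun x : K => x ≠ 0 ∧ (δ : WithTop Γ) < v x) (fun x y : K => v (h x - h y) = κ) (by
        intro s hs
        obtain ⟨M, hM⟩ := (s.image D).exists_le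
        obtain ⟨b, hb0, hb⟩ := T.exists_near (max δ M)
        refine ⟨b, ⟨hb0, (coe_le_max_left _ _).trans_lt hb⟩, fun x hx => ?_⟩
        refine hD x (hs x hx).1 (lt_of_le_of_lt (by exact_mod_cast hδ) (hs x hx).2) b hb0
          (lt_of_le_of_lt ?_ ((coe_le_max_right _ _).trans_lt hb))
        exact_mod_cast hM _ (Finset.mem_image_of_mem _ hx))
    exact ⟨y, h1, fun i j hij => h2 hij⟩
  -- The points `y i` are fixed before the radius `d`, which lies beyond all `D (y i)`, `i ≤ N`. The
  -- set of residue classes met by `h` inside that radius contains the class of each `h (y' j)` but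
  -- of no `h (y i)`, although `N` centres cannot tell them apart.
  obtain ⟨y, hy0, hy⟩ := hseq δ₂ le_rfl
  obtain ⟨M, hM⟩ := ((Finset.range (N + 1)).image fun i => D (y i)).exists_le
  obtain ⟨y', hy0', hy'⟩ := hseq (max δ₂ M) (le_max_left _ _)
  obtain ⟨d, hd⟩ := T.surj (max δ₂ M : Γ)
  obtain ⟨P, hPN, hP⟩ := hN d
  have hcard : P.card < (Finset.range (N + 1)).card := by
    rw [Finset.card_range]; omega
  obtain ⟨i, hi, hiP⟩ := exists_general_position (y := fun i => h (y i)) hy P _ hcard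
  obtain ⟨j, hj, hjP⟩ := exists_general_position (y := fun i => h (y' i)) hy' P _ hcard
  have hfar : ∀ b, b ≠ 0 → v d < v b → v (h (y i) - h b) = κ := by
    intro b hb0 hb
    refine hD (y i) (hy0 i).1 (hy0 i).2 b hb0 (lt_of_le_of_lt ?_ (hd ▸ hb))
    refine le_trans ?_ (coe_le_max_right _ _)
    exact_mod_cast hM _ (Finset.mem_image_of_mem _ hi)
  have h1 := (hP.iff_of_le hjP hiP (by
    rw [v.map_sub_swap, hfar _ (hy0' j).1 (hd ▸ (hy0' j).2)])).1
    ⟨y' j, (hy0' j).1, hd ▸ (hy0' j).2, by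
      rw [sub_self, v.map_zero]; exact WithTop.coe_lt_top _⟩
  obtain ⟨b, hb0, hb, hlt⟩ := h1
  rw [v.map_sub_swap, hfar b hb0 hb] at hlt
  exact lt_irrefl _ hlt

/-- A definable function which is bounded near `0` has the Cauchy property at `0`. -/
theorem cauchy [IsAlgClosed K] [Nontrivial Γ] {h : K → K} (hh : DMap L K h) {β δ₀ : Γ}
    (hb : ∀ b, b ≠ 0 → (δ₀ : WithTop Γ) < v b → β ≤ v (h b)) (σ : Γ) :
    ∃ δ : Γ, ∀ a b, a ≠ 0 → b ≠ 0 → (δ : WithTop Γ) < v a → (δ : WithTop Γ) < v b →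
      (σ : WithTop Γ) < v (h a - h b) := by
  classical
  by_contra hcon
  -- For fixed `a`, either all `h b` with `b` near `0` are within `σ` of `h a`, which already gives
  -- the Cauchy property, or none is.
  have hd : ∀ a, ∃ d : Γ, ∀ b, b ≠ 0 → (d : WithTop Γ) < v b → v (h a - h b) ≤ σ := by
    intro a
    have hdef : Dfn L K fun b => (σ : WithTop Γ) < v (h a - h b) :=
      T.const_lt_v (T.sub (DMap.const _) hh) _
    obtain ⟨d, h1 | h1⟩ := T.germ hdef 0
    · simp only [sub_zero] at h1
      refine absurd ⟨d, fun b b' hb0 hb0' hb hb' => ?_⟩ hcon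
      refine v_lt_sub_of_lt (y := h a) ?_ (h1 b' hb0' hb')
      rw [v.map_sub_swap]
      exact h1 b hb0 hb
    · exact ⟨d, fun b hb0 hb => not_lt.1 (h1 b hb0 (by rwa [sub_zero]))⟩
  have hk : ∀ a, ∃ κ D : Γ, a ≠ 0 → (δ₀ : WithTop Γ) < v a →
      ∀ b, b ≠ 0 → (D : WithTop Γ) < v b → v (h a - h b) = κ := by
    intro a
    by_cases ha : a ≠ 0 ∧ (δ₀ : WithTop Γ) < v a
    · obtain ⟨d, hd⟩ := hd a
      obtain ⟨κ, D, hD⟩ := T.eventually_const (H := fun b => v (h a - h b)) (β := β) (σ := σ)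
        (δ₀ := max δ₀ d) (T.v_le (DMap.snd DMap.id)
          (T.sub (DMap.const _) (hh.comp (DMap.fst DMap.id)))) (fun b hb0 hb' =>
          ⟨v.map_le_sub (hb a ha.1 ha.2) (hb b hb0 ((coe_le_max_left _ _).trans_lt hb')),
            hd b hb0 ((coe_le_max_right _ _).trans_lt hb')⟩)
      exact ⟨κ, D, fun _ _ => hD⟩
    · exact ⟨0, 0, fun h1 h2 => absurd ⟨h1, h2⟩ ha⟩
  choose κ D hD using hk
  -- The eventual distance `κ a` is again a definable function bounded by `β` and `σ`, so it is
  -- constant near `0`: this is the excluded situation of generic differences. The value `⊤` outside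
  -- the domain makes the hypograph condition vacuous there.
  let H : K → WithTop Γ := fun a => if a ≠ 0 ∧ (δ₀ : WithTop Γ) < v a then κ a else ⊤
  have hH : Dfn L K fun p : K × K => v p.2 ≤ H p.1 := by
    have key : ∀ p : K × K, v p.2 ≤ H p.1 ↔ ((¬ p.1 = 0) ∧ (δ₀ : WithTop Γ) < v p.1 →
        ∃ d : K, (¬ d = 0) ∧ ∀ b : K, (¬ b = 0) → v d < v b → v p.2 ≤ v (h p.1 - h b)) := by
      rintro ⟨a, c⟩
      by_cases ha : a ≠ 0 ∧ (δ₀ : WithTop Γ) < v a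
      · have hHa : H a = κ a := if_pos ha
        simp only [hHa, ha, not_false_iff, and_self, true_imp_iff]
        constructor
        · intro hc
          obtain ⟨d, hd⟩ := T.surj (D a)
          refine ⟨d, v_ne_zero hd, fun b hb0 hb => ?_⟩
          rw [hD a ha.1 ha.2 b hb0 (hd ▸ hb)]
          exact hc
        · rintro ⟨d, hd0, hd⟩
          obtain ⟨δ, hδ⟩ := exists_v_eq (v := v) hd0
          obtain ⟨b, hb0, hb⟩ := T.exists_near (max (D a) δ)
          rw [← hD a ha.1 ha.2 b hb0 ((coe_le_max_left _ _).trans_lt hb)]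
          exact hd b hb0 (hδ ▸ (coe_le_max_right _ _).trans_lt hb)
      · have hHa : H a = ⊤ := if_neg ha
        simp only [hHa, le_top, true_iff]
        exact fun h => absurd h ha
    simp only [key]
    with_reducible repeat' first
        | apply DMap.id | apply DMap.const | apply DMap.fst | apply DMap.snd | apply Dfn.and
        | apply Dfn.not | apply Dfn.imp | apply Dfn.ex | apply Dfn.all | apply T.v_le
        | apply T.v_lt | apply T.const_lt_v | apply DMap.eq | apply T.sub | apply hh.comp
  obtain ⟨k, δ₁, hk⟩ := T.eventually_const hH (β := β) (σ := σ) (δ₀ := δ₀) (by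
    intro a ha0 ha
    have hHa : H a = κ a := if_pos ⟨ha0, ha⟩
    obtain ⟨d, hd⟩ := hd a
    obtain ⟨b, hb0, hb'⟩ := T.exists_near (max (max δ₀ d) (D a))
    have h1 := (coe_le_max_left (max δ₀ d) _).trans_lt hb'
    rw [hHa, ← hD a ha0 ha b hb0 ((coe_le_max_right _ _).trans_lt hb')]
    exact ⟨v.map_le_sub (hb a ha0 ha) (hb b hb0 ((coe_le_max_left _ _).trans_lt h1)),
      hd b hb0 ((coe_le_max_right _ _).trans_lt h1)⟩)
  refine T.not_generic_differences hh k (max δ₀ δ₁) D fun a ha0 ha b hb0 hb' => ?_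
  have ha' := (coe_le_max_left _ _).trans_lt ha
  have hHa : H a = κ a := if_pos ⟨ha0, ha'⟩
  rw [hD a ha0 ha' b hb0 hb', ← hHa, hk a ha0 ((coe_le_max_right _ _).trans_lt ha)]

/-- A definable function which is bounded near `0` has a limit at `0`. -/
theorem exists_limit [IsAlgClosed K] [Nontrivial Γ] {h : K → K} (hh : DMap L K h) {β δ₀ : Γ}
    (hb : ∀ b, b ≠ 0 → (δ₀ : WithTop Γ) < v b → β ≤ v (h b)) :
    ∃ l : K, ∀ σ : Γ, ∃ δ : Γ, ∀ b, b ≠ 0 → (δ : WithTop Γ) < v b →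
      (σ : WithTop Γ) < v (h b - l) := by
  let W : Set (Fin 1 → K) := {w | w 0 ≠ 0}
  -- The fibre over `w` is the open ball of radius `v (w 0)` containing `h b` for all `b` close to
  -- `0`; a common point of these balls is the limit.
  let X : Set ((Fin 1 → K) × K) := {p | (¬ p.1 0 = 0) ∧
    ∃ d : K, (¬ d = 0) ∧ ∀ b : K, (¬ b = 0) → v d < v b → v (p.1 0) < v (h b - p.2)}
  have hfib : ∀ w ∈ W, ∀ γ : Γ, v (w 0) = γ → ∃ c, fiber X w = openBall v c (γ : WithBot Γ) := by
    intro w hw γ hγ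
    obtain ⟨δ, hδ⟩ := T.cauchy hh hb γ
    obtain ⟨c, hc0, hc⟩ := T.exists_near δ
    obtain ⟨d, hd⟩ := T.surj δ
    refine ⟨h c, ?_⟩
    ext z
    rw [mem_openBall_coe]
    constructor
    · rintro ⟨-, d', hd0', hd'⟩
      obtain ⟨δ', hδ'⟩ := exists_v_eq (v := v) hd0'
      obtain ⟨b, hb0, hb'⟩ := T.exists_near (max δ δ')
      have h1 := hd' b hb0 (hδ' ▸ (coe_le_max_right _ _).trans_lt hb')
      simp only [hγ] at h1
      rw [v.map_sub_swap] at h1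
      exact v_lt_sub_of_lt h1 (hδ b c hb0 hc0 ((coe_le_max_left _ _).trans_lt hb') hc)
    · intro hz
      refine ⟨hw, d, v_ne_zero hd, fun b hb0 hb' => ?_⟩
      simp only [hγ]
      rw [v.map_sub_swap] at hz
      exact v_lt_sub_of_lt (hδ b c hb0 hc0 (hd ▸ hb') hc) hz
  have hfam : IsDefinableFamily L W X := by
    refine ⟨?_, ?_, ?_⟩
    · have : Dfn L K fun w : Fin 1 → K => ¬ w 0 = 0 :=
        ((DMap.apply DMap.id 0).eq (DMap.const 0)).not
      exact this
    · rw [dfn_iff_definableProd]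
      simp only [X, Set.mem_ofPred_eq]
      with_reducible repeat' first
          | apply DMap.id | apply DMap.const | apply DMap.fst | apply DMap.snd | apply Dfn.and
          | apply Dfn.not | apply Dfn.imp | apply Dfn.ex | apply Dfn.all | apply T.v_lt
          | apply DMap.eq | apply T.sub | apply hh.comp | apply DMap.apply
    · ext w
      constructor
      · rintro ⟨⟨w, z⟩, hz, rfl⟩
        exact hz.1
      · intro hw
        obtain ⟨γ, hγ⟩ := exists_v_eq (v := v) (show w 0 ≠ 0 from hw)
        obtain ⟨c, hc⟩ := hfib w hw γ hγ
        have : c ∈ fiber X w := by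
          rw [hc, mem_openBall_coe]
          simp
        exact ⟨(w, c), this, rfl⟩
  obtain ⟨l, hl⟩ := T.complete 1 W X hfam (by
    intro w hw
    obtain ⟨γ, hγ⟩ := exists_v_eq (v := v) (show w 0 ≠ 0 from hw)
    obtain ⟨c, hc⟩ := hfib w hw γ hγ
    exact Or.inr ⟨c, γ, hc⟩) (by
    intro w hw w' hw'
    rcases le_total (v (w 0)) (v (w' 0)) with hle | hle
    · refine Or.inr fun z hz => ⟨hw, ?_⟩
      obtain ⟨-, d, hd0, hd⟩ := hz
      exact ⟨d, hd0, fun b hb0 hb' => hle.trans_lt (hd b hb0 hb')⟩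
    · refine Or.inl fun z hz => ⟨hw', ?_⟩
      obtain ⟨-, d, hd0, hd⟩ := hz
      exact ⟨d, hd0, fun b hb0 hb' => hle.trans_lt (hd b hb0 hb')⟩) (by
    intro γ
    obtain ⟨γ', hγ'⟩ := exists_gt γ
    obtain ⟨c, hc⟩ := T.surj γ'
    have hw : (fun _ => c : Fin 1 → K) ∈ W := v_ne_zero hc
    obtain ⟨z, hz⟩ := hfib _ hw γ' hc
    exact ⟨_, hw, Or.inr ⟨z, γ', by exact_mod_cast hγ', hz⟩⟩)
  refine ⟨l, fun σ => ?_⟩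
  obtain ⟨c, hc⟩ := T.surj σ
  have hw : (fun _ => c : Fin 1 → K) ∈ W := v_ne_zero hc
  obtain ⟨-, d, hd0, hd⟩ := Set.mem_iInter₂.1 hl _ hw
  obtain ⟨δ, hδ⟩ := exists_v_eq (v := v) hd0
  refine ⟨δ, fun b hb0 hb' => ?_⟩
  have := hd b hb0 (hδ ▸ hb')
  simp only [hc] at this
  exact this

/-- A bounded definable function from a ball to the residue classes of radius `κ` is constant on
some ball. -/
theorem exists_ball_const_residue [IsAlgClosed K] [Nontrivial Γ] {g : K → K} {κ γ : Γ} {a : K}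
    (hg : Dfn L K fun p : K × K =>
      (γ : WithTop Γ) < v (p.2 - a) ∧ (κ : WithTop Γ) < v (g p.2 - p.1))
    (hb : ∀ x, (γ : WithTop Γ) < v (x - a) → κ ≤ v (g x)) :
    ∃ z b : K, ∃ δ : Γ, (γ : WithTop Γ) < v (b - a) ∧ γ ≤ δ ∧
      ∀ x, (δ : WithTop Γ) < v (x - b) → (κ : WithTop Γ) < v (g x - z) := by
  classical
  by_contra! hcon
  obtain ⟨N, hN⟩ := T.uniform_support (R := fun z x : K =>
    (γ : WithTop Γ) < v (x - a) ∧ (κ : WithTop Γ) < v (g x - z)) hg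
  choose P hPN hP using hN
  -- A point of a fibre outside its support would give a ball inside the fibre, so each fibre lies
  -- in its support and has at most `N` points.
  have hmem : ∀ z x, (γ : WithTop Γ) < v (x - a) → (κ : WithTop Γ) < v (g x - z) → x ∈ P z := by
    intro z x hx hz
    by_contra hxP
    obtain ⟨δ, hδ⟩ := (hP z).exists_ball hxP
    obtain ⟨y, hy1, hy2⟩ := hcon z x (max γ δ) hx (le_max_left _ _)
    exact absurd ((hδ y ((coe_le_max_right _ _).trans_lt hy1)).2 ⟨hx, hz⟩).2 (not_lt.2 hy2)
  obtain ⟨γ', hγ'⟩ := exists_gt γ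
  obtain ⟨γ'', hγ''⟩ := exists_gt γ'
  obtain ⟨y, hya, hy⟩ := exists_seq_far T.surj γ' a
  have hball : ∀ i x, (γ' : WithTop Γ) < v (x - y i) → (γ : WithTop Γ) < v (x - a) := by
    intro i x hx
    have h1 : (γ : WithTop Γ) < γ' := by exact_mod_cast hγ'
    exact v_lt_sub_of_lt (h1.trans hx) (by rwa [hya])
  have hQ : ∀ i, ∃ Q : Finset K, IsSupport v Q fun z => ∃ x, (γ' : WithTop Γ) < v (x - y i) ∧
      ((γ : WithTop Γ) < v (x - a) ∧ (κ : WithTop Γ) < v (g x - z)) := by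
    intro i
    refine T.exists_support (Dfn.ex ((T.const_lt_v (T.sub (DMap.snd DMap.id) (DMap.const _)) _).and
      (hg.comp₂ (R := fun z x => (γ : WithTop Γ) < v (x - a) ∧ (κ : WithTop Γ) < v (g x - z))
        (DMap.fst DMap.id) (DMap.snd DMap.id))))
  choose Q hQ using hQ
  set QQ : Finset K := (Finset.range (N + 1)).biUnion Q with hQQ
  -- The points to avoid lie in finitely many finite fibres, so each of the disjoint balls has a
  -- point whose image is in general position with respect to `QQ`.
  have hx : ∀ i, ∃ x, (γ' : WithTop Γ) < v (x - y i) ∧ ∀ q ∈ QQ, v (g x - q) ≤ κ := by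
    intro i
    obtain ⟨x, hx, hxE⟩ := exists_far T.surj γ'' (y i) (QQ.biUnion P)
    have hx' : (γ' : WithTop Γ) < v (x - y i) := by
      rw [hx]; exact_mod_cast hγ''
    refine ⟨x, hx', fun q hq => not_lt.1 fun hlt => ?_⟩
    have := hxE x (Finset.mem_biUnion.2 ⟨q, hq, hmem q x (hball i x hx') hlt⟩)
    rw [sub_self, v.map_zero, top_le_iff] at this
    exact WithTop.coe_ne_top this
  choose x hx hxQ using hx
  -- `Q i` does not separate `g (x 0)` from `g (x i)`, so the class of `g (x 0)` is hit from the
  -- `i`-th ball as well. This gives `N + 1` points in one fibre.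
  have hhit : ∀ i, ∃ x', i ∈ Finset.range (N + 1) →
      (γ' : WithTop Γ) < v (x' - y i) ∧ x' ∈ P (g (x 0)) := by
    intro i
    by_cases hi : i ∈ Finset.range (N + 1)
    · have hsub : ∀ q ∈ Q i, q ∈ QQ := fun q hq => Finset.mem_biUnion.2 ⟨i, hi, hq⟩
      obtain ⟨x', h1, h2, h3⟩ := ((hQ i).iff_of_le (fun q hq => hxQ i q (hsub q hq))
        (fun q hq => hxQ 0 q (hsub q hq)) (v.map_le_sub (hb _ (hball i _ (hx i)))
          (hb _ (hball 0 _ (hx 0))))).1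
        ⟨x i, hx i, hball i _ (hx i), by rw [sub_self, v.map_zero]; exact WithTop.coe_lt_top _⟩
      exact ⟨x', fun _ => ⟨h1, hmem _ _ h2 h3⟩⟩
    · exact ⟨0, fun h => absurd h hi⟩
  choose x' hx' using hhit
  have hcard := Finset.card_le_card_of_injOn (s := Finset.range (N + 1)) (t := P (g (x 0))) x'
    (fun i hi => (hx' i hi).2) (by
      intro i hi j hj hij
      by_contra hne
      have h1 := (hx' i hi).1
      have h2 := (hx' j hj).1
      rw [← hij] at h2
      rw [v.map_sub_swap] at h1
      exact (v_lt_sub_of_lt h1 h2).ne' (hy i j hne))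
  rw [Finset.card_range] at hcard
  have := hPN (g (x 0))
  omega

end TameField

end Field

/-! ### The C-relation in terms of distances, and powers near `1`. -/

section Valued

variable {K : Type w} [Field K] {Γ : Type w'} [AddCommGroup Γ] [LinearOrder Γ]
  [IsOrderedAddMonoid Γ] {v : AddValuation K (WithTop Γ)}

/-- `f` preserves and reflects the `C`-relation on `B`. -/
def PreservesC (v : AddValuation K (WithTop Γ)) (f : K → K) (B : Set K) : Prop :=
  ∀ x ∈ B, ∀ y ∈ B, ∀ z ∈ B, CRel v x y z ↔ CRel v (f x) (f y) (f z)

/-- Through this equivalence, preserving the `C`-relation means preserving the strict order of the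
distances from any given point. -/
theorem v_sub_lt_iff_cRel {x y z : K} : v (x - y) < v (x - z) ↔ CRel v y x z := by
  constructor
  · intro h
    have h1 : v (z - y) = v (x - y) := v_sub_eq_of_lt h
    have h2 : v (y - z) = v (x - y) := by rw [v.map_sub_swap, h1]
    exact ⟨by rw [h2, v.map_sub_swap], by rwa [h2]⟩
  · rintro ⟨h1, h2⟩
    rw [v.map_sub_swap, h1]
    exact h2

theorem PreservesC.lt_iff {f : K → K} {B : Set K} (h : PreservesC v f B) {x y z : K} (hx : x ∈ B)
    (hy : y ∈ B) (hz : z ∈ B) : v (x - y) < v (x - z) ↔ v (f x - f y) < v (f x - f z) := by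
  rw [v_sub_lt_iff_cRel, v_sub_lt_iff_cRel]
  exact h y hy x hx z hz

theorem v_natCast_nonneg (n : ℕ) : 0 ≤ v (n : K) := by
  induction n with
  | zero => simp
  | succ n ih =>
    push_cast
    exact v.map_le_add ih v.map_one.ge

theorem v_pow_sub_one_ge {z : K} (hz : 0 ≤ v (z - 1)) (n : ℕ) : v (z - 1) ≤ v (z ^ n - 1) := by
  have hz0 : 0 ≤ v z := by
    have : z = (z - 1) + 1 := by ring
    rw [this]
    exact v.map_le_add hz v.map_one.ge
  induction n with
  | zero => simp
  | succ n ih =>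
    have e : z ^ (n + 1) - 1 = z * (z ^ n - 1) + (z - 1) := by ring
    rw [e]
    refine v.map_le_add ?_ le_rfl
    rw [v.map_mul]
    exact ih.trans (le_add_of_nonneg_left hz0)

/-- Close to `1` the map `z ↦ z ^ n` multiplies distances by `n`. -/
theorem v_pow_sub_one {z : K} {n : ℕ} (hz : v (n : K) < v (z - 1)) :
    v (z ^ n - 1) = v (n : K) + v (z - 1) := by
  have hz0 : 0 ≤ v (z - 1) := (v_natCast_nonneg n).trans hz.le
  -- The geometric sum is `n` plus terms `z ^ i - 1` of value at least `v (z - 1)`, which exceeds `v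
  -- n`.
  have hsum : v (∑ i ∈ Finset.range n, z ^ i) = v (n : K) := by
    have e : ∑ i ∈ Finset.range n, z ^ i = (n : K) + ∑ i ∈ Finset.range n, (z ^ i - 1) := by
      rw [Finset.sum_sub_distrib]
      simp
    rw [e]
    exact v.map_add_eq_of_lt_left
      (hz.trans_le (v.map_le_sum fun i _ => v_pow_sub_one_ge hz0 i))
  rw [← geom_sum_mul, v.map_mul, hsum]

end Valued

/-! ### Uniform radii and linearity on values of differences. -/

section Field

variable {L : FirstOrder.Language.{u₁, u₂}} {φ : Ldiv →ᴸ L} {K : Type w} [Field K]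
    [L.Structure K] {Γ : Type w'} [AddCommGroup Γ] [LinearOrder Γ] [IsOrderedAddMonoid Γ]
    {v : AddValuation K (WithTop Γ)} (T : TameField φ v)
include T

namespace TameField

/-- A property of the points of a ball which holds for all sufficiently small radii holds with a
uniform radius on a smaller ball. -/
theorem exists_uniform_radius [IsAlgClosed K] [Nontrivial Γ] {V : K → K → Prop}
    (hV : Dfn L K fun p : K × K => V p.1 p.2)
    (hmono : ∀ x d d', V x d → v d ≤ v d' → V x d') {a : K} {γ : Γ}
    (hex : ∀ x, (γ : WithTop Γ) < v (x - a) → ∃ d, d ≠ 0 ∧ V x d) :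
    ∃ b : K, ∃ δ ε : Γ, ∃ d : K, (γ : WithTop Γ) < v (b - a) ∧ γ ≤ δ ∧ v d = (ε : WithTop Γ) ∧
      ∀ x, (δ : WithTop Γ) < v (x - b) → V x d := by
  -- Points are preordered by inclusion of their sets of admissible radii; the preorder is total
  -- because these sets are upward closed in `v d`.
  have hdef : Dfn L K fun p : K × K => ∀ d : K, (¬ d = 0) → V p.1 d → V p.2 d := by
    exact Dfn.all ((((DMap.snd DMap.id).eq (DMap.const 0)).not).imp
      ((hV.comp₂ (DMap.fst (DMap.fst DMap.id)) (DMap.snd DMap.id)).imp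
        (hV.comp₂ (DMap.snd (DMap.fst DMap.id)) (DMap.snd DMap.id))))
  obtain ⟨b, hb, δ, hδ, h⟩ := T.preorder_ball
    (R := fun x y => ∀ d : K, (¬ d = 0) → V x d → V y d) hdef (by
      intro x y
      by_contra! hcon
      obtain ⟨⟨d, hd0, hx, hy⟩, d', hd0', hy', hx'⟩ := hcon
      rcases le_total (v d) (v d') with hle | hle
      · exact hx' (hmono x d d' hx hle)
      · exact hy (hmono y d' d hy' hle)) (fun x y z h1 h2 d hd0 hd => h2 d hd0 (h1 d hd0 hd)) a γ
  obtain ⟨d, hd0, hd⟩ := hex b hb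
  obtain ⟨ε, hε⟩ := exists_v_eq (v := v) hd0
  refine ⟨b, δ, ε, d, hb, hδ, hε, fun x hx => h b x ?_ hx d hd0 hd⟩
  rw [sub_self, v.map_zero]
  exact WithTop.coe_lt_top _

/-- On a small ball, a definable function preserving the `C`-relation multiplies values of
differences by a positive rational number, up to an additive constant. -/
theorem exists_ball_qLinear [IsAlgClosed K] [Nontrivial Γ] {f : K → K} (hf : DMap L K f) {a : K}
    {γ : Γ} (hC : PreservesC v f {x | (γ : WithTop Γ) < v (x - a)}) :
    ∃ b : K, ∃ Δ α : Γ, ∃ r : ℚ, (γ : WithTop Γ) < v (b - a) ∧ γ ≤ Δ ∧ 0 < r ∧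
      ∀ y z, (Δ : WithTop Γ) < v (y - b) → (Δ : WithTop Γ) < v (z - b) →
        ∀ ε : Γ, v (y - z) = ε → ∃ η : Γ, v (f y - f z) = η ∧ r.den • (η - α) = r.num • ε := by
  classical
  -- Points are compared by the germs at `0` of `s ↦ v (f (x + s) - f x)`; any two germs are
  -- comparable since a definable set near `0` is all or nothing.
  have hdef₁ : Dfn L K fun p : K × K => ∃ d : K, (¬ d = 0) ∧ ∀ s : K, (¬ s = 0) → v d < v s →
      v (f (p.1 + s) - f p.1) ≤ v (f (p.2 + s) - f p.2) := by
    with_reducible repeat' first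
        | apply DMap.id | apply DMap.const | apply DMap.fst | apply DMap.snd | apply Dfn.and
        | apply Dfn.not | apply Dfn.imp | apply Dfn.ex | apply Dfn.all | apply T.v_le
        | apply T.v_lt | apply DMap.eq | apply T.sub | apply T.add | apply hf.comp
  obtain ⟨b₁, hb₁, δ₁, hδ₁, h₁⟩ := T.preorder_ball (R := fun x y => ∃ d : K, (¬ d = 0) ∧
      ∀ s : K, (¬ s = 0) → v d < v s → v (f (x + s) - f x) ≤ v (f (y + s) - f y)) hdef₁ (by
    intro x y
    have hd : Dfn L K fun s => v (f (x + s) - f x) ≤ v (f (y + s) - f y) := by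
      with_reducible repeat' first
          | apply DMap.id | apply DMap.const | apply T.v_le | apply T.sub | apply T.add
          | apply hf.comp
    obtain ⟨δ, h⟩ := T.germ hd 0
    simp only [sub_zero] at h
    obtain ⟨d, hd⟩ := T.surj δ
    rcases h with h | h
    · exact Or.inl ⟨d, v_ne_zero hd, fun s hs0 hs => h s hs0 (hd ▸ hs)⟩
    · exact Or.inr ⟨d, v_ne_zero hd, fun s hs0 hs => (not_le.1 (h s hs0 (hd ▸ hs))).le⟩) (by
    rintro x y z ⟨d, hd0, hd⟩ ⟨d', hd0', hd'⟩
    rcases le_total (v d) (v d') with hle | hle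
    · exact ⟨d', hd0', fun s hs0 hs => (hd s hs0 (hle.trans_lt hs)).trans (hd' s hs0 hs)⟩
    · exact ⟨d, hd0, fun s hs0 hs => (hd s hs0 hs).trans (hd' s hs0 (hle.trans_lt hs))⟩) a γ
  have hself : ∀ (x : K) (δ : Γ), (δ : WithTop Γ) < v (x - x) := fun x δ => by
    rw [sub_self, v.map_zero]; exact WithTop.coe_lt_top _
  -- All germs near `b₁` now agree with the one at `b₁`, each on a neighbourhood depending on the
  -- point; the next step makes the neighbourhood uniform.
  have hdef₂ : Dfn L K fun p : K × K => ∀ s : K, (¬ s = 0) → v p.2 < v s →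
      v (f (p.1 + s) - f p.1) = v (f (b₁ + s) - f b₁) := by
    with_reducible repeat' first
        | apply DMap.id | apply DMap.const | apply DMap.fst | apply DMap.snd | apply Dfn.not
        | apply Dfn.imp | apply Dfn.all | apply T.v_eq | apply T.v_lt | apply DMap.eq
        | apply T.sub | apply T.add | apply hf.comp
  obtain ⟨b₂, δ₂, ε₂, d₂, hb₂, hδ₂, hd₂, h₂⟩ := T.exists_uniform_radius
    (V := fun x d => ∀ s : K, (¬ s = 0) → v d < v s →
      v (f (x + s) - f x) = v (f (b₁ + s) - f b₁)) hdef₂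
    (fun x d d' h hle s hs0 hs => h s hs0 (hle.trans_lt hs)) (a := b₁) (γ := δ₁) (by
    intro x hx
    obtain ⟨d, hd0, hd⟩ := h₁ x b₁ hx (hself _ _)
    obtain ⟨d', hd0', hd'⟩ := h₁ b₁ x (hself _ _) hx
    rcases le_total (v d) (v d') with hle | hle
    · exact ⟨d', hd0', fun s hs0 hs =>
        le_antisymm (hd s hs0 (hle.trans_lt hs)) (hd' s hs0 hs)⟩
    · exact ⟨d, hd0, fun s hs0 hs =>
        le_antisymm (hd s hs0 hs) (hd' s hs0 (hle.trans_lt hs))⟩)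
  -- the function on the value group induced by `f` at `b₁`
  have hB : ∀ s : K, (γ : WithTop Γ) < v s → (γ : WithTop Γ) < v (b₁ + s - a) := by
    intro s hs
    have e : b₁ + s - a = (b₁ - a) + s := by ring
    rw [e]
    exact v.map_lt_add hb₁ hs
  have hlt : ∀ s s' : K, (γ : WithTop Γ) < v s → (γ : WithTop Γ) < v s' →
      (v s < v s' ↔ v (f (b₁ + s) - f b₁) < v (f (b₁ + s') - f b₁)) := by
    intro s s' hs hs'
    have := hC.lt_iff (x := b₁) hb₁ (hB s hs) (hB s' hs')
    simp only [v.map_sub_swap b₁, v.map_sub_swap (f b₁), add_sub_cancel_left] at this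
    exact this
  have heq : ∀ s s' : K, (γ : WithTop Γ) < v s → (γ : WithTop Γ) < v s' → v s = v s' →
      v (f (b₁ + s) - f b₁) = v (f (b₁ + s') - f b₁) := by
    intro s s' hs hs' he
    refine le_antisymm (not_lt.1 fun h => ?_) (not_lt.1 fun h => ?_)
    · exact ((hlt s' s hs' hs).2 h).ne he.symm
    · exact ((hlt s s' hs hs').2 h).ne he
  have hex : ∀ ε : Γ, ∃ η : Γ, (γ < ε → ∀ s, v s = ε → v (f (b₁ + s) - f b₁) = η) ∧
      (¬ γ < ε → η = 0) := by
    intro ε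
    by_cases hε : γ < ε
    · obtain ⟨s, hs⟩ := T.surj ε
      have hs' : (γ : WithTop Γ) < v s := by rw [hs]; exact_mod_cast hε
      have h0 := (hlt s 0 hs' (by rw [v.map_zero]; exact WithTop.coe_lt_top _)).1
        (by rw [hs, v.map_zero]; exact WithTop.coe_lt_top _)
      obtain ⟨η, hη⟩ := WithTop.ne_top_iff_exists.1 h0.ne_top
      exact ⟨η, fun _ s' he => by
        rw [hη]; exact heq s' s (by rw [he]; exact_mod_cast hε) hs' (he.trans hs.symm),
        fun h => absurd hε h⟩
    · exact ⟨0, fun h => absurd h hε, fun _ => rfl⟩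
  choose g hg hg0 using hex
  have hgdef : IsDefinableGammaFun v L g := by
    have key : ∀ p : K × K, (∃ ε : Γ, v p.1 = (ε : WithTop Γ) ∧ v p.2 = (g ε : WithTop Γ)) ↔
        (¬ p.1 = 0) ∧ (((γ : WithTop Γ) < v p.1 ∧ v p.2 = v (f (b₁ + p.1) - f b₁)) ∨
          (¬ (γ : WithTop Γ) < v p.1 ∧ v p.2 = 0)) := by
      rintro ⟨x, z⟩
      constructor
      · rintro ⟨ε, h1, h2⟩
        refine ⟨v_ne_zero h1, ?_⟩
        simp only at h1 h2 ⊢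
        rw [h2]
        by_cases hε : γ < ε
        · exact Or.inl ⟨by rw [h1]; exact_mod_cast hε, (hg ε hε x h1).symm⟩
        · exact Or.inr ⟨by rw [h1]; exact_mod_cast hε, by rw [hg0 ε hε]; rfl⟩
      · rintro ⟨h1, h3⟩
        obtain ⟨ε, hε⟩ := exists_v_eq (v := v) h1
        refine ⟨ε, hε, ?_⟩
        simp only at h3 hε ⊢
        rcases h3 with ⟨h3, h4⟩ | ⟨h3, h4⟩
        · rw [hε] at h3
          rw [h4, hg ε (by exact_mod_cast h3) x hε]
        · rw [hε] at h3
          rw [h4, hg0 ε (by exact_mod_cast h3)]; rfl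
    have hdef : Dfn L K fun p : K × K =>
        ∃ ε : Γ, v p.1 = (ε : WithTop Γ) ∧ v p.2 = (g ε : WithTop Γ) := by
      simp only [key]
      with_reducible repeat' first
          | apply DMap.id | apply DMap.const | apply DMap.fst | apply DMap.snd | apply Dfn.and
          | apply Dfn.or | apply Dfn.not | apply T.v_eq | apply T.const_lt_v | apply T.v_eq_const
          | apply DMap.eq | apply T.sub | apply T.add | apply hf.comp
    exact Set.Definable.preimage_comp (Sum.elim (fun _ : Unit => (0 : Fin 2)) fun _ : Unit => 1)
      hdef
  obtain ⟨δ₃, α, r, hr⟩ := T.qLinear g hgdef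
  have hγδ₂ : γ ≤ δ₂ := hδ₁.trans hδ₂
  refine ⟨b₂, max (max δ₂ ε₂) δ₃, α, r, ?_, hγδ₂.trans ((le_max_left _ _).trans (le_max_left _ _)),
    ?_, ?_⟩
  · exact v_lt_sub_of_lt (lt_of_le_of_lt (by exact_mod_cast hδ₁) hb₂) hb₁
  · -- `g` is strictly increasing
    obtain ⟨ε, hε⟩ := exists_gt (max γ δ₃)
    obtain ⟨ε', hε'⟩ := exists_gt ε
    have e1 := hr ε ((le_max_right _ _).trans_lt hε)
    have e2 := hr ε' (((le_max_right _ _).trans_lt hε).trans hε')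
    have g1 := (le_max_left _ _).trans_lt hε
    obtain ⟨s, hs⟩ := T.surj ε
    obtain ⟨s', hs'⟩ := T.surj ε'
    have h3 := (hlt s s' (by rw [hs]; exact_mod_cast g1)
      (by rw [hs']; exact_mod_cast g1.trans hε')).1 (by rw [hs, hs']; exact_mod_cast hε')
    rw [hg ε g1 s hs, hg ε' (g1.trans hε') s' hs', WithTop.coe_lt_coe] at h3
    have h4 : r.num • ε < r.num • ε' := by
      rw [← e1, ← e2]
      exact nsmul_lt_nsmul_right r.den_nz (sub_lt_sub_right h3 α)
    have h5 : 0 < r.num • (ε' - ε) := by rwa [zsmul_sub, sub_pos]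
    rw [← Rat.num_pos]
    by_contra hneg
    push Not at hneg
    have h6 : r.num • (ε' - ε) ≤ 0 := by
      have h7 : (0 : Γ) ≤ (-r.num) • (ε' - ε) :=
        zsmul_nonneg (sub_pos.2 hε').le (by omega)
      rwa [neg_zsmul, neg_nonneg] at h7
    exact absurd h5 (not_lt.2 h6)
  · intro y z hy hz ε hε
    have hΔ : max (max δ₂ ε₂) δ₃ < ε := by
      have : ((max (max δ₂ ε₂) δ₃ : Γ) : WithTop Γ) < v (y - z) := by
        rw [v.map_sub_swap] at hz
        exact v_lt_sub_of_lt hy hz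
      rw [hε] at this
      exact_mod_cast this
    have h3 := (le_max_left (max δ₂ ε₂) δ₃).trans_lt hΔ
    have h4 := (le_max_left δ₂ ε₂).trans_lt h3
    refine ⟨g ε, ?_, hr ε ((le_max_right _ _).trans_lt hΔ)⟩
    have h5 := h₂ z ((coe_le_max_left _ _).trans_lt ((coe_le_max_left _ _).trans_lt hz)) (y - z)
      (v_ne_zero hε) (by rw [hd₂, hε]; exact_mod_cast (le_max_right _ _).trans_lt h3)
    rw [add_sub_cancel] at h5
    rw [h5]
    exact hg ε (hγδ₂.trans_lt h4) _ hε

end TameField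

end Field

/-! ### Slope one in characteristic `0`, and approximation by affine functions. -/

section Field

variable {L : FirstOrder.Language.{u₁, u₂}} {φ : Ldiv →ᴸ L} {K : Type w} [Field K]
    [L.Structure K] {Γ : Type w'} [AddCommGroup Γ] [LinearOrder Γ] [IsOrderedAddMonoid Γ]
    {v : AddValuation K (WithTop Γ)} (T : TameField φ v)
include T

namespace TameField

/-- In characteristic `0`, a definable function multiplying values of differences by a positive
rational number `r`, up to an additive constant, has `r = 1`. -/
theorem eq_one_of_qLinear [IsAlgClosed K] [CharZero K] [Nontrivial Γ] {f : K → K}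
    (hf : DMap L K f) {b : K} {Δ α : Γ} {r : ℚ} (hr : 0 < r)
    (h : ∀ y z, (Δ : WithTop Γ) < v (y - b) → (Δ : WithTop Γ) < v (z - b) →
        ∀ ε : Γ, v (y - z) = ε → ∃ η : Γ, v (f y - f z) = η ∧ r.den • (η - α) = r.num • ε) :
    r = 1 := by
  obtain ⟨m, hm⟩ := Int.eq_ofNat_of_zero_le (Rat.num_pos.2 hr).le
  set n := r.den with hn
  have hn0 : n ≠ 0 := r.den_nz
  have hm0 : m ≠ 0 := by
    rintro rfl
    exact (Rat.num_pos.2 hr).ne' (by simpa using hm)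
  simp only [hm, natCast_zsmul] at h
  obtain ⟨A, hA⟩ := exists_v_eq (v := v) (Nat.cast_ne_zero (R := K).2 hn0)
  obtain ⟨B, hB⟩ := exists_v_eq (v := v) (Nat.cast_ne_zero (R := K).2 hm0)
  have hA0 : 0 ≤ A := by
    have := v_natCast_nonneg (v := v) n
    rw [hA] at this; exact_mod_cast this
  have hB0 : 0 ≤ B := by
    have := v_natCast_nonneg (v := v) m
    rw [hB] at this; exact_mod_cast this
  set u : K → K := fun s => f (b + s) - f b with hu
  -- With `r = m / n`, the value of `u ^ n / s ^ m` is the constant `n • α`; boundedness gives the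
  -- Cauchy property at `0`.
  set q : K → K := fun s => u s ^ n / s ^ m with hq
  have huv : ∀ (s : K) (ε : Γ), Δ < ε → v s = ε → ∃ η : Γ, v (u s) = η ∧ n • (η - α) = m • ε := by
    intro s ε hε hs
    refine h (b + s) b ?_ ?_ ε (by rwa [add_sub_cancel_left])
    · rw [add_sub_cancel_left, hs]; exact_mod_cast hε
    · rw [sub_self, v.map_zero]; exact WithTop.coe_lt_top _
  have hqv : ∀ s : K, s ≠ 0 → (Δ : WithTop Γ) < v s → v (q s) = ((n • α : Γ) : WithTop Γ) := by
    intro s hs0 hs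
    obtain ⟨ε, hε⟩ := exists_v_eq (v := v) hs0
    obtain ⟨η, hη, he⟩ := huv s ε (by rw [hε] at hs; exact_mod_cast hs) hε
    have h1 : v (q s) + v (s ^ m) = v (u s ^ n) := by
      rw [← v.map_mul, hq]
      simp only
      rw [div_mul_cancel₀ _ (pow_ne_zero m hs0)]
    rw [v.map_pow, v.map_pow, hε, hη] at h1
    obtain ⟨ρ, hρ⟩ := exists_v_eq (v := v) (c := q s) (by
      intro h0
      rw [h0, v.map_zero, top_add] at h1
      exact WithTop.coe_ne_top (a := n • η) (by exact_mod_cast h1.symm))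
    rw [hρ] at h1 ⊢
    have h2 : ρ + m • ε = n • η := by exact_mod_cast h1
    rw [nsmul_sub] at he
    have : ρ = n • α := by
      rw [← he] at h2
      have := eq_sub_of_add_eq h2
      rw [this]; abel
    rw [this]
  have hqdef : DMap L K q := by
    with_reducible repeat' first
        | apply DMap.id | apply DMap.const | apply T.div | apply T.pow | apply T.sub | apply T.add
        | apply hf.comp
  -- the exponents `m` and `n` agree when compared on `1 + e` with `e` small
  have key : ∀ ε : Γ, max (n • A) (max B 0) < ε → n • A + m • ε = n • B + n • ε := by
    intro ε hε
    have hε0 : 0 < ε := ((le_max_right _ _).trans (le_max_right _ _)).trans_lt hε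
    have hεB : B < ε := ((le_max_left _ _).trans (le_max_right _ _)).trans_lt hε
    have hεA : n • A < ε := (le_max_left _ _).trans_lt hε
    obtain ⟨e, he⟩ := T.surj ε
    -- Beyond the value `n • α` of `q`, the precision is at least both `v (z ^ n - 1) = A + ζ` and
    -- `v (τ ^ m - 1) = B + ε`, so closeness of `z ^ n` to `τ ^ m` makes these values equal.
    obtain ⟨δ, hδ⟩ := T.cauchy hqdef (β := n • α) (δ₀ := Δ)
      (fun s hs0 hs => (hqv s hs0 hs).ge) (n • α + (A + B + ε + m • ε))
    obtain ⟨s, hs0, hs⟩ := T.exists_near (max Δ δ)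
    obtain ⟨σ, hσ⟩ := exists_v_eq (v := v) hs0
    have hsΔ := (coe_le_max_left _ _).trans_lt hs
    have hsδ := (coe_le_max_right _ _).trans_lt hs
    have hΔσ : Δ < σ := by rw [hσ] at hsΔ; exact_mod_cast hsΔ
    set τ : K := 1 + e with hτ
    have hτv : v τ = 0 := by
      rw [hτ, v.map_add_eq_of_lt_left, v.map_one]
      rw [v.map_one, he]; exact_mod_cast hε0
    have hτ0 : τ ≠ 0 := by
      intro h0; rw [h0, v.map_zero] at hτv; exact WithTop.coe_ne_top (a := (0 : Γ)) hτv.symm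
    have hτs : v (τ * s) = v s := by rw [v.map_mul, hτv, zero_add]
    obtain ⟨η, hη, heη⟩ := huv s σ hΔσ hσ
    have hu0 : u s ≠ 0 := v_ne_zero hη
    -- `z = u (τ s) / u s` satisfies `v (z - 1) = (m / n) ε`
    set z : K := u (τ * s) / u s with hz
    obtain ⟨η', hη', heη'⟩ := h (b + τ * s) (b + s) (by rwa [add_sub_cancel_left, hτs])
      (by rwa [add_sub_cancel_left]) (ε + σ) (by
        have : b + τ * s - (b + s) = e * s := by rw [hτ]; ring
        rw [this, v.map_mul, he, hσ]; rfl)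
    have hz1 : (z - 1) * u s = f (b + τ * s) - f (b + s) := by
      rw [hz, sub_mul, div_mul_cancel₀ _ hu0, hu]; simp only; ring
    obtain ⟨ζ, hζ⟩ : ∃ ζ : Γ, v (z - 1) = ζ := by
      refine exists_v_eq (v := v) fun h0 => ?_
      rw [h0, zero_mul] at hz1
      rw [← hz1, v.map_zero] at hη'
      exact WithTop.coe_ne_top hη'.symm
    have hζη : ζ + η = η' := by
      have := congrArg v hz1
      rw [v.map_mul, hζ, hη, hη'] at this
      exact_mod_cast this
    have hnζ : n • ζ = m • ε := by
      have e1 : n • ζ = n • (η' - α) - n • (η - α) := by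
        rw [← hζη, ← nsmul_sub]; congr 1; abel
      rw [e1, heη', heη, nsmul_add]; abel
    have hAζ : A < ζ := by
      refine lt_of_nsmul_lt_nsmul_right n ?_
      rw [hnζ]
      refine hεA.trans_le ?_
      simpa using nsmul_le_nsmul_left hε0.le (Nat.one_le_iff_ne_zero.2 hm0)
    have hzn : v (z ^ n - 1) = ((A + ζ : Γ) : WithTop Γ) := by
      rw [v_pow_sub_one (by rw [hA, hζ]; exact_mod_cast hAζ), hA, hζ]; rfl
    have hτm : v (τ ^ m - 1) = ((B + ε : Γ) : WithTop Γ) := by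
      have hτ1 : τ - 1 = e := by rw [hτ]; ring
      rw [v_pow_sub_one (by rw [hτ1, hB, he]; exact_mod_cast hεB), hτ1, hB, he]; rfl
    have hζle : ζ ≤ m • ε := by
      have hζ0 : 0 ≤ ζ := hA0.trans hAζ.le
      rw [← hnζ]
      simpa using nsmul_le_nsmul_left hζ0 (Nat.one_le_iff_ne_zero.2 hn0)
    -- `z ^ n` is close to `τ ^ m`
    have hclose : ((A + B + ε + m • ε : Γ) : WithTop Γ) < v (z ^ n - τ ^ m) := by
      have h1 := hδ (τ * s) s (mul_ne_zero hτ0 hs0) hs0 (by rwa [hτs]) hsδ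
      have hqs := hqv s hs0 hsΔ
      have h2 : q (τ * s) - q s = (z ^ n - τ ^ m) * (q s / τ ^ m) := by
        simp only [hq, hz, div_pow, mul_pow]
        field_simp
      rw [h2, v.map_mul] at h1
      have h3 : v (q s / τ ^ m) = ((n • α : Γ) : WithTop Γ) := by
        have h4 : v (q s / τ ^ m) + v (τ ^ m) = v (q s) := by
          rw [← v.map_mul, div_mul_cancel₀ _ (pow_ne_zero m hτ0)]
        rw [v.map_pow, hτv, nsmul_zero, add_zero, hqs] at h4
        exact h4
      rw [h3] at h1
      by_contra hcon
      have h5 := add_le_add_left (not_lt.1 hcon) ((n • α : Γ) : WithTop Γ)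
      refine absurd (h1.trans_le h5) (not_lt.2 ?_)
      rw [← WithTop.coe_add, add_comm]
    have heq : v (z ^ n - 1) = v (τ ^ m - 1) := by
      refine v_sub_eq_of_le (γ := ((A + B + ε + m • ε : Γ) : WithTop Γ)) ?_ ?_ hclose.le
      · rw [hzn, WithTop.coe_le_coe]
        calc A + ζ ≤ A + m • ε := by gcongr
          _ ≤ (A + m • ε) + (B + ε) := le_add_of_nonneg_right (add_nonneg hB0 hε0.le)
          _ = A + B + ε + m • ε := by abel
      · rw [hτm, WithTop.coe_le_coe]
        calc B + ε ≤ (B + ε) + (A + m • ε) :=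
              le_add_of_nonneg_right (add_nonneg hA0 (nsmul_nonneg hε0.le m))
          _ = A + B + ε + m • ε := by abel
    rw [hzn, hτm, WithTop.coe_inj] at heq
    rw [← hnζ, ← nsmul_add, heq, nsmul_add]
  obtain ⟨ε, hε⟩ := exists_gt (max (n • A) (max B 0))
  obtain ⟨ε', hε'⟩ := exists_gt ε
  have k1 := key ε hε
  have k2 := key ε' (hε.trans hε')
  -- Subtracting the relations for two values of `ε` removes the constants `n • A` and `n • B`.
  have k3 : m • (ε' - ε) = n • (ε' - ε) := by
    rw [nsmul_sub, nsmul_sub]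
    have e1 : m • ε = n • B + n • ε - n • A := eq_sub_of_add_eq' k1
    have e2 : m • ε' = n • B + n • ε' - n • A := eq_sub_of_add_eq' k2
    rw [e1, e2]; abel
  have hmn : m = n := (nsmul_left_strictMono (sub_pos.2 hε')).injective k3
  have h1 : (r.num : ℚ) / r.den = r := r.num_div_den
  rw [← h1, hm, ← hn, hmn]
  have : (n : ℚ) ≠ 0 := Nat.cast_ne_zero.2 hn0
  simp [this]

/-- In characteristic `0`, a definable function preserving the `C`-relation on a ball is, on some
smaller ball, close to an affine function. -/
theorem exists_ball_almost_affine [IsAlgClosed K] [CharZero K] [Nontrivial Γ] {f : K → K}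
    (hf : DMap L K f) {a : K} {γ : Γ} (hC : PreservesC v f {x | (γ : WithTop Γ) < v (x - a)}) :
    ∃ b : K, ∃ Δ α : Γ, ∃ d : K, (γ : WithTop Γ) < v (b - a) ∧ γ ≤ Δ ∧ v d = (α : WithTop Γ) ∧
      ∀ y z, (Δ : WithTop Γ) < v (y - b) → (Δ : WithTop Γ) < v (z - b) → y ≠ z →
        v d < v ((f y - f z) / (y - z) - d) := by
  classical
  obtain ⟨b₁, δ₁, α, r, hb₁, hδ₁, hr, h₁⟩ := T.exists_ball_qLinear hf hC
  obtain rfl := T.eq_one_of_qLinear hf hr h₁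
  have hval : ∀ y z, (δ₁ : WithTop Γ) < v (y - b₁) → (δ₁ : WithTop Γ) < v (z - b₁) → y ≠ z →
      v ((f y - f z) / (y - z)) = α := by
    intro y z hy hz hyz
    obtain ⟨ε, hε⟩ := exists_v_eq (v := v) (sub_ne_zero.2 hyz)
    obtain ⟨η, hη, he⟩ := h₁ y z hy hz ε hε
    simp only [Rat.den_ofNat, Rat.num_ofNat, one_nsmul, one_zsmul] at he
    have h2 : v ((f y - f z) / (y - z)) + v (y - z) = v (f y - f z) := by
      rw [← v.map_mul, div_mul_cancel₀ _ (sub_ne_zero.2 hyz)]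
    rw [hε, hη] at h2
    have h3 : η = α + ε := by rw [← he]; abel
    rw [h3, WithTop.coe_add] at h2
    exact WithTop.add_right_cancel WithTop.coe_ne_top h2
  set Q : K → K → K := fun x s => (f (x + s) - f x) / s with hQ
  have hadd : ∀ x s, (δ₁ : WithTop Γ) < v (x - b₁) → (δ₁ : WithTop Γ) < v s →
      (δ₁ : WithTop Γ) < v (x + s - b₁) := by
    intro x s hx hs
    have e : x + s - b₁ = (x - b₁) + s := by ring
    rw [e]
    exact v.map_lt_add hx hs
  have hQv : ∀ x s, (δ₁ : WithTop Γ) < v (x - b₁) → s ≠ 0 → (δ₁ : WithTop Γ) < v s →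
      v (Q x s) = α := by
    intro x s hx hs0 hs
    have := hval (x + s) x (hadd x s hx hs) hx (by simpa using hs0)
    rwa [add_sub_cancel_left] at this
  have hQdef : ∀ x, DMap L K (Q x) := by
    intro x
    with_reducible repeat' first
        | apply DMap.id | apply DMap.const | apply T.div | apply T.sub | apply T.add
        | apply hf.comp
  -- the residue class of the derivative at `x`
  have hg : ∀ x, ∃ δ : Γ, ∃ g : K, (δ₁ : WithTop Γ) < v (x - b₁) → (α : WithTop Γ) ≤ v g ∧
      ∀ s, s ≠ 0 → (δ : WithTop Γ) < v s → (α : WithTop Γ) < v (Q x s - g) := by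
    intro x
    by_cases hx : (δ₁ : WithTop Γ) < v (x - b₁)
    · obtain ⟨δ, hδ⟩ := T.cauchy (hQdef x) (β := α) (δ₀ := δ₁)
        (fun s hs0 hs => (hQv x s hx hs0 hs).ge) α
      obtain ⟨s, hs0, hs⟩ := T.exists_near (max δ₁ δ)
      exact ⟨δ, Q x s, fun _ => ⟨(hQv x s hx hs0 ((coe_le_max_left _ _).trans_lt hs)).ge,
        fun s' hs0' hs' => hδ s' s hs0' hs0 hs' ((coe_le_max_right _ _).trans_lt hs)⟩⟩
    · exact ⟨0, 0, fun h => absurd h hx⟩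
  choose D g hg using hg
  -- The representative `g x` is chosen arbitrarily, but its residue class is determined by the
  -- difference quotients, hence definable.
  have hgiff : ∀ x z, (δ₁ : WithTop Γ) < v (x - b₁) → ((α : WithTop Γ) < v (g x - z) ↔
      ∃ d : K, (¬ d = 0) ∧ ∀ s : K, (¬ s = 0) → v d < v s →
        (α : WithTop Γ) < v ((f (x + s) - f x) / s - z)) := by
    intro x z hx
    obtain ⟨d, hd⟩ := T.surj (D x)
    constructor
    · intro h
      exact ⟨d, v_ne_zero hd, fun s hs0 hs => v_lt_sub_of_lt ((hg x hx).2 s hs0 (hd ▸ hs)) h⟩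
    · rintro ⟨d', hd0', hd'⟩
      obtain ⟨δ', hδ'⟩ := exists_v_eq (v := v) hd0'
      obtain ⟨s, hs0, hs⟩ := T.exists_near (max (D x) δ')
      have h1 := (hg x hx).2 s hs0 ((coe_le_max_left _ _).trans_lt hs)
      rw [v.map_sub_swap] at h1
      exact v_lt_sub_of_lt h1 (hd' s hs0 (hδ' ▸ (coe_le_max_right _ _).trans_lt hs))
  have hgdef : Dfn L K fun p : K × K =>
      (δ₁ : WithTop Γ) < v (p.2 - b₁) ∧ (α : WithTop Γ) < v (g p.2 - p.1) := by
    have : ∀ p : K × K, ((δ₁ : WithTop Γ) < v (p.2 - b₁) ∧ (α : WithTop Γ) < v (g p.2 - p.1)) ↔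
        ((δ₁ : WithTop Γ) < v (p.2 - b₁) ∧ ∃ d : K, (¬ d = 0) ∧ ∀ s : K, (¬ s = 0) → v d < v s →
        (α : WithTop Γ) < v ((f (p.2 + s) - f p.2) / s - p.1)) := fun p =>
      and_congr_right fun h => hgiff p.2 p.1 h
    simp only [this]
    with_reducible repeat' first
        | apply DMap.id | apply DMap.const | apply DMap.fst | apply DMap.snd | apply Dfn.and
        | apply Dfn.not | apply Dfn.imp | apply Dfn.ex | apply Dfn.all | apply T.v_lt
        | apply T.const_lt_v | apply DMap.eq | apply T.div | apply T.sub | apply T.add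
        | apply hf.comp
  obtain ⟨d, b₂, δ₂, hb₂, hδ₂, h₂⟩ := T.exists_ball_const_residue hgdef fun x hx => (hg x hx).1
  have hmono₂ : ∀ x, (δ₂ : WithTop Γ) < v (x - b₂) → (δ₁ : WithTop Γ) < v (x - b₁) := fun x hx =>
    v_lt_sub_of_lt (lt_of_le_of_lt (by exact_mod_cast hδ₂) hx) hb₂
  have hVdef : Dfn L K fun p : K × K => ∀ s : K, (¬ s = 0) → v p.2 < v s →
      (α : WithTop Γ) < v ((f (p.1 + s) - f p.1) / s - d) := by
    with_reducible repeat' first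
        | apply DMap.id | apply DMap.const | apply DMap.fst | apply DMap.snd | apply Dfn.not
        | apply Dfn.imp | apply Dfn.all | apply T.v_lt | apply T.const_lt_v | apply DMap.eq
        | apply T.div | apply T.sub | apply T.add | apply hf.comp
  obtain ⟨b₃, δ₃, ε, c, hb₃, hδ₃, hc, h₃⟩ := T.exists_uniform_radius
    (V := fun x c => ∀ s : K, (¬ s = 0) → v c < v s →
      (α : WithTop Γ) < v ((f (x + s) - f x) / s - d)) hVdef
    (fun x c c' h hle s hs0 hs => h s hs0 (hle.trans_lt hs)) (a := b₂) (γ := δ₂) (by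
      intro x hx
      exact (hgiff x d (hmono₂ x hx)).1 (h₂ x hx))
  have hclose : ∀ y z, ((max δ₃ ε : Γ) : WithTop Γ) < v (y - b₃) →
      ((max δ₃ ε : Γ) : WithTop Γ) < v (z - b₃) → y ≠ z →
      (α : WithTop Γ) < v ((f y - f z) / (y - z) - d) := by
    intro y z hy hz hyz
    have := h₃ z ((coe_le_max_left _ _).trans_lt hz) (y - z) (sub_ne_zero.2 hyz) (by
      rw [v.map_sub_swap] at hz
      rw [hc]
      exact (coe_le_max_right _ _).trans_lt (v_lt_sub_of_lt hy hz))
    rwa [add_sub_cancel] at this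
  have hmono₃ : ∀ x, ((max δ₃ ε : Γ) : WithTop Γ) < v (x - b₃) →
      (δ₁ : WithTop Γ) < v (x - b₁) := fun x hx =>
    hmono₂ x (v_lt_sub_of_lt (lt_of_le_of_lt (by exact_mod_cast hδ₃)
      ((coe_le_max_left _ _).trans_lt hx)) hb₃)
  have hd : v d = α := by
    obtain ⟨s, hs0, hs⟩ := T.exists_near (max δ₃ ε)
    have hself : ((max δ₃ ε : Γ) : WithTop Γ) < v (b₃ - b₃) := by
      rw [sub_self, v.map_zero]; exact WithTop.coe_lt_top _
    have hs' : ((max δ₃ ε : Γ) : WithTop Γ) < v (b₃ + s - b₃) := by rwa [add_sub_cancel_left]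
    have hne : b₃ + s ≠ b₃ := by simpa using hs0
    have h5 := hclose _ _ hs' hself hne
    have h6 := hval _ _ (hmono₃ _ hs') (hmono₃ _ hself) hne
    rw [v.map_sub_swap, ← h6] at h5
    rw [v.map_eq_of_lt_sub h5, h6]
  refine ⟨b₃, max δ₃ ε, α, d, ?_, hδ₁.trans (hδ₂.trans (hδ₃.trans (le_max_left _ _))), hd,
    fun y z hy hz hyz => hd ▸ hclose y z hy hz hyz⟩
  have h1 : (δ₁ : WithTop Γ) < v (b₃ - b₁) :=
    hmono₂ _ hb₃
  exact v_lt_sub_of_lt (lt_of_le_of_lt (by exact_mod_cast hδ₁) h1) hb₁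

end TameField

end Field

/-! ### The map `rv` and elementary facts on open balls. -/

section Valued

variable {K : Type w} [Field K] {Γ : Type w'} [AddCommGroup Γ] [LinearOrder Γ]
  [IsOrderedAddMonoid Γ] {v : AddValuation K (WithTop Γ)}

theorem rv_zero : rv v (0 : K) = 0 := dif_pos rfl

theorem rv_mul (x y : K) : rv v (x * y) = rv v x * rv v y := by
  by_cases hx : x = 0
  · simp [hx, rv_zero]
  by_cases hy : y = 0
  · simp [hy, rv_zero]
  rw [rv, rv, rv, dif_neg hx, dif_neg hy, dif_neg (mul_ne_zero hx hy), Units.mk0_mul, map_mul,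
    WithZero.coe_mul]

theorem ne_zero_of_close {x d : K} (h : v d < v (x - d)) : x ≠ 0 := by
  rintro rfl
  rw [zero_sub, v.map_neg] at h
  exact lt_irrefl _ h

theorem rv_eq_of_close {x d : K} (hd : d ≠ 0) (h : v d < v (x - d)) : rv v x = rv v d := by
  have hx := ne_zero_of_close h
  rw [rv, rv, dif_neg hx, dif_neg hd, WithZero.coe_inj, eq_comm]
  refine QuotientGroup.eq.2 ?_
  change 0 < v ((((Units.mk0 d hd)⁻¹ * Units.mk0 x hx : Kˣ) : K) - 1)
  have e : (((Units.mk0 d hd)⁻¹ * Units.mk0 x hx : Kˣ) : K) - 1 = (x - d) / d := by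
    rw [Units.val_mul, Units.val_inv_eq_inv_val, Units.val_mk0, Units.val_mk0]
    field_simp
  have h2 : v ((x - d) / d) + v d = v (x - d) := by
    rw [← v.map_mul, div_mul_cancel₀ _ hd]
  rw [e]
  by_contra hcon
  have h3 := add_le_add_left (not_lt.1 hcon) (v d)
  rw [h2, zero_add] at h3
  exact absurd h (not_lt.2 h3)

theorem IsOpenBall.exists_radius {B : Set K} (hB : IsOpenBall v B) {x : K} (hx : x ∈ B) :
    ∃ γ : Γ, ∀ y, (γ : WithTop Γ) < v (y - x) → y ∈ B := by
  obtain ⟨a, ρ, rfl⟩ := hB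
  induction ρ with
  | bot => exact ⟨0, fun y _ => by simp [openBall]⟩
  | coe γ =>
    rw [mem_openBall_coe] at hx
    exact ⟨γ, fun y hy => mem_openBall_coe.2 (v_lt_sub_of_lt hy hx)⟩

/-- Two points of an open ball are at a distance already beyond its radius. Applied to the image
ball, this provides preimages. -/
theorem IsOpenBall.mem_of_lt {B : Set K} (hB : IsOpenBall v B) {x y z : K} (hx : x ∈ B)
    (hy : y ∈ B) (h : v (x - y) < v (z - x)) : z ∈ B := by
  obtain ⟨a, ρ, rfl⟩ := hB
  induction ρ with
  | bot => simp [openBall]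
  | coe γ =>
    rw [mem_openBall_coe] at hx hy ⊢
    rw [v.map_sub_swap] at hy
    exact v_lt_sub_of_lt ((v_lt_sub_of_lt hx hy).trans h) hx

end Valued

/-! ### The Jacobian property near a good point. -/

section Field

variable {L : FirstOrder.Language.{u₁, u₂}} {φ : Ldiv →ᴸ L} {K : Type w} [Field K]
    [L.Structure K] {Γ : Type w'} [AddCommGroup Γ] [LinearOrder Γ] [IsOrderedAddMonoid Γ]
    {v : AddValuation K (WithTop Γ)} (T : TameField φ v)
include T

namespace TameField

/-- A definable local `C`-isomorphism which near `x` is close to an affine function has the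
Jacobian property near `x`. -/
theorem exists_hasJacobianProperty [IsAlgClosed K] [Nontrivial Γ] {f : K → K} (hf : DMap L K f)
    {x d : K} {γ : Γ} (hd : d ≠ 0) (h : ∀ y z, (γ : WithTop Γ) < v (y - x) →
      (γ : WithTop Γ) < v (z - x) → y ≠ z → v d < v ((f y - f z) / (y - z) - d))
    {B : Set K} (hB : IsOpenBall v B) (hx : x ∈ B) (hiso : IsCIsoOn v f B) :
    ∃ B' : Set K, IsOpenBall v B' ∧ x ∈ B' ∧ (∀ y ∈ B', (γ : WithTop Γ) < v (y - x)) ∧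
      HasJacobianProperty v f B' := by
  classical
  obtain ⟨γ₁, hγ₁⟩ := hB.exists_radius hx
  -- A radius strictly beyond both bounds keeps the sphere of radius `ρ` inside `B`; its point `x +
  -- s` determines the radius of the image ball.
  obtain ⟨ρ, hρ⟩ := exists_gt (max γ γ₁)
  obtain ⟨s, hs⟩ := T.surj ρ
  have hs0 := v_ne_zero hs
  have hργ : ∀ y, (ρ : WithTop Γ) ≤ v (y - x) → (γ : WithTop Γ) < v (y - x) := fun y hy =>
    lt_of_lt_of_le (by exact_mod_cast (le_max_left _ _).trans_lt hρ) hy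
  have hρB : ∀ y, (ρ : WithTop Γ) ≤ v (y - x) → y ∈ B := fun y hy =>
    hγ₁ y (lt_of_lt_of_le (by exact_mod_cast (le_max_right _ _).trans_lt hρ) hy)
  have hne : ∀ y z, (γ : WithTop Γ) < v (y - x) → (γ : WithTop Γ) < v (z - x) → y ≠ z →
      f y ≠ f z := fun y z hy hz hyz he => by
    have := h y z hy hz hyz
    rw [he, sub_self, zero_div, zero_sub, v.map_neg] at this
    exact lt_irrefl _ this
  have hmem : ∀ y, y ∈ openBall v x (ρ : WithBot Γ) ↔ (ρ : WithTop Γ) < v (y - x) := fun y =>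
    mem_openBall_coe
  have hself : (γ : WithTop Γ) < v (x - x) := by
    rw [sub_self, v.map_zero]; exact WithTop.coe_lt_top _
  refine ⟨openBall v x (ρ : WithBot Γ), ⟨x, ρ, rfl⟩, ?_, fun y hy => hργ y ((hmem y).1 hy).le,
    ?_, ?_, ?_⟩
  · rw [hmem, sub_self, v.map_zero]; exact WithTop.coe_lt_top _
  · intro y hy z hz he
    by_contra hyz
    exact hne y z (hργ y ((hmem y).1 hy).le) (hργ z ((hmem z).1 hz).le) hyz he
  · -- the image is the open ball bounded by the image of the sphere through `x + s`
    have hxs : v (x + s - x) = ρ := by rw [add_sub_cancel_left, hs]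
    have hxsB : x + s ∈ B := hρB _ hxs.ge
    obtain ⟨ε, hε⟩ := exists_v_eq (v := v) (sub_ne_zero.2
      (hne (x + s) x (hργ _ hxs.ge) hself (by simpa using hs0)))
    refine ⟨f x, ε, ?_⟩
    have hlt : ∀ y ∈ B, (ρ : WithTop Γ) < v (y - x) ↔ (ε : WithTop Γ) < v (f y - f x) := by
      intro y hy
      rw [← hxs, ← hε, v.map_sub_swap, v.map_sub_swap y, v.map_sub_swap (f (x + s)),
        v.map_sub_swap (f y)]
      exact PreservesC.lt_iff (B := B) hiso.2 hx hxsB hy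
    ext z
    rw [mem_openBall_coe]
    constructor
    · rintro ⟨y, hy, rfl⟩
      have hy' := (hmem y).1 hy
      exact (hlt y (hρB y hy'.le)).1 hy'
    · intro hz
      obtain ⟨y, hy, rfl⟩ := hiso.1.mem_of_lt (Set.mem_image_of_mem f hx)
        (Set.mem_image_of_mem f hxsB) (z := z) (by rw [v.map_sub_swap, hε]; exact hz)
      exact ⟨y, (hmem y).2 ((hlt y hy).2 hz), rfl⟩
  -- The derivative is the limit of the difference quotients, which are bounded since they have the
  -- value of `d`; the limit stays in the class `d(1 + 𝓜)`.
  · have hlim : ∀ y, ∃ l : K, (ρ : WithTop Γ) < v (y - x) →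
        HasValDerivOn v f (openBall v x (ρ : WithBot Γ)) y l ∧ v d < v (l - d) := by
      intro y
      by_cases hy : (ρ : WithTop Γ) < v (y - x)
      · have hadd : ∀ s, (ρ : WithTop Γ) < v s → (ρ : WithTop Γ) < v (y + s - x) := by
          intro s hs
          have e : y + s - x = (y - x) + s := by ring
          rw [e]
          exact v.map_lt_add hy hs
        have hQ : ∀ s, s ≠ 0 → (ρ : WithTop Γ) < v s →
            v d < v ((f (y + s) - f y) / s - d) := by
          intro s hs0 hs
          have := h (y + s) y (hργ _ (hadd s hs).le) (hργ y hy.le) (by simpa using hs0)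
          rwa [add_sub_cancel_left] at this
        obtain ⟨β, hβ⟩ := exists_v_eq (v := v) hd
        have hdef : DMap L K fun s => (f (y + s) - f y) / s := by
          with_reducible repeat' first
              | apply DMap.id | apply DMap.const | apply T.div | apply T.sub | apply T.add
              | apply hf.comp
        obtain ⟨l, hl⟩ := T.exists_limit hdef (β := β) (δ₀ := ρ) (fun s hs0 hs => by
          have h1 := hQ s hs0 hs
          rw [← hβ, v.map_eq_of_lt_sub h1])
        refine ⟨l, fun _ => ⟨fun σ => ?_, ?_⟩⟩
        · obtain ⟨δ, hδ⟩ := hl σ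
          refine ⟨δ, fun y' _ hne' hy' => ?_⟩
          have := hδ (y' - y) (sub_ne_zero.2 hne') hy'
          rwa [add_sub_cancel] at this
        · obtain ⟨δ, hδ⟩ := hl β
          obtain ⟨s, hs0, hs⟩ := T.exists_near (max δ ρ)
          have h1 := hδ s hs0 ((coe_le_max_left _ _).trans_lt hs)
          rw [v.map_sub_swap, ← hβ] at h1
          exact v_lt_sub_of_lt h1 (hQ s hs0 ((coe_le_max_right _ _).trans_lt hs))
      · exact ⟨0, fun h => absurd h hy⟩
    choose f' hf' using hlim
    refine ⟨f', fun y hy => ⟨(hf' y ((hmem y).1 hy)).1,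
      ne_zero_of_close (hf' y ((hmem y).1 hy)).2⟩, rv v d, fun y hy =>
      rv_eq_of_close hd (hf' y ((hmem y).1 hy)).2, fun y hy z hz => ?_⟩
    by_cases hyz : y = z
    · rw [hyz, sub_self, sub_self, rv_zero, zero_mul]
    · have h1 := h y z (hργ y ((hmem y).1 hy).le) (hργ z ((hmem z).1 hz).le) hyz
      rw [← rv_eq_of_close hd h1, ← rv_mul, mul_div_cancel₀ _ (sub_ne_zero.2 hyz)]

end TameField

end Field

/-! ### Assembly of the theorem. -/

theorem hasJacobianProperty_congr {K : Type w} [Field K] {Γ : Type w'} [AddCommGroup Γ]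
    [LinearOrder Γ] [IsOrderedAddMonoid Γ] {v : AddValuation K (WithTop Γ)} {f g : K → K}
    {B : Set K} (hfg : Set.EqOn f g B) (h : HasJacobianProperty v f B) :
    HasJacobianProperty v g B := by
  obtain ⟨h1, h2, f', h3, c, h4, h5⟩ := h
  refine ⟨h1.congr hfg, hfg.image_eq ▸ h2, f', fun x hx => ⟨fun γ => ?_, (h3 x hx).2⟩, c, h4,
    fun x hx y hy => ?_⟩
  · obtain ⟨δ, hδ⟩ := (h3 x hx).1 γ
    refine ⟨δ, fun y hy => ?_⟩
    rw [← hfg hx, ← hfg hy]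
    exact hδ y hy
  · rw [← hfg hx, ← hfg hy]
    exact h5 x hx y hy

theorem isCIsoOn_congr {K : Type w} [Field K] {Γ : Type w'} [AddCommGroup Γ]
    [LinearOrder Γ] [IsOrderedAddMonoid Γ] {v : AddValuation K (WithTop Γ)} {f g : K → K}
    {B : Set K} (hfg : Set.EqOn f g B) (h : IsCIsoOn v f B) : IsCIsoOn v g B := by
  refine ⟨hfg.image_eq ▸ h.1, fun x hx y hy z hz => ?_⟩
  rw [← hfg hx, ← hfg hy, ← hfg hz]
  exact h.2 x hx y hy z hz

theorem mainTheorem8 {L : FirstOrder.Language.{u₁, u₂}} (φ : Ldiv →ᴸ L)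
    {K : Type w} [Field K] [IsAlgClosed K] [CharZero K] [L.Structure K]
    {Γ : Type w'} [AddCommGroup Γ] [LinearOrder Γ] [IsOrderedAddMonoid Γ] [Nontrivial Γ]
    (v : AddValuation K (WithTop Γ)) (hv : Function.Surjective v)
    (hexp : ExpandsValuedField φ v)
    (hmin : IsCMinimal φ K)
    (hcomplete : IsDefinablyComplete v L)
    (hlin : ∀ g : Γ → Γ, IsDefinableGammaFun v L g → EventuallyQLinear g)
    {n : ℕ} (W : Set (Fin n → K)) (X : Set ((Fin n → K) × K)) (f : (Fin n → K) → K → K)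
    (hX : IsDefinableFamily L W X) (hf : IsDefinableFunOn L X f)
    (hiso : ∀ w ∈ W, IsLocalCIsoOn v (f w) (fiber X w)) :
    ∃ F : Set ((Fin n → K) × K), F ⊆ X ∧ DefinableProd L F ∧
      ∀ w ∈ W, (fiber F w).Finite ∧
        HasLocallyJacobianProperty v (f w) (fiber X w \ fiber F w) := by
  classical
  have T : TameField φ v := ⟨hv, hexp, hmin, hcomplete, hlin⟩
  have hXd : Dfn L K fun p : (Fin n → K) × K => p ∈ X := dfn_iff_definableProd.1 hX.total
  -- the extension of `f` by `0`
  let g : (Fin n → K) × K → K := fun p => if p ∈ X then f p.1 p.2 else 0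
  have hgX : ∀ w x, (w, x) ∈ X → g (w, x) = f w x := fun w x h => if_pos h
  have hg : DMap L K g := by
    refine DMap.of_graph ?_
    have h1 : Dfn L K fun p : ((Fin n → K) × K) × K => p.1 ∈ X ∧ p.2 = f p.1.1 p.1.2 :=
      Set.Definable.preimage_comp (Sum.elim (fun i => Sum.inl (Sum.inl i))
        ![Sum.inl (Sum.inr ()), Sum.inr ()]) hf
    have h2 : ∀ p : ((Fin n → K) × K) × K, p.2 = g p.1 ↔
        (p.1 ∈ X ∧ p.2 = f p.1.1 p.1.2) ∨ ((¬ p.1 ∈ X) ∧ p.2 = 0) := by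
      intro p
      by_cases h : p.1 ∈ X <;> simp [g, h]
    simp only [h2]
    exact h1.or ((hXd.comp (DMap.fst DMap.id)).not.and ((DMap.snd DMap.id).eq (DMap.const 0)))
  have hgw : ∀ w, DMap L K fun x => g (w, x) := fun w => hg.comp ((DMap.const w).pair DMap.id)
  -- `G` is the set of good points: `c` gives the radius of the ball and `d` the class of the
  -- difference quotients. Both are elements of `K`, so the condition is first-order in `(w, x)`.
  let G : (Fin n → K) × K → Prop := fun p => ∃ c : K, (¬ c = 0) ∧ ∃ d : K, (¬ d = 0) ∧
    ∀ y z : K, v c < v (y - p.2) → v c < v (z - p.2) → (p.1, y) ∈ X ∧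
      ((¬ y = z) → v d < v ((g (p.1, y) - g (p.1, z)) / (y - z) - d))
  have hG : Dfn L K G := by
    with_reducible repeat' first
        | apply DMap.id | apply DMap.const | apply DMap.fst | apply DMap.snd | apply DMap.pair
        | apply Dfn.and | apply Dfn.not | apply Dfn.imp | apply Dfn.ex | apply Dfn.all
        | apply T.v_lt | apply hXd.comp | apply DMap.eq | apply T.div | apply T.sub
        | apply hg.comp
  have hF : Dfn L K fun p : (Fin n → K) × K => p ∈ X ∧ ¬ G p := hXd.and hG.not
  refine ⟨{p | p ∈ X ∧ ¬ G p}, fun p hp => hp.1, dfn_iff_definableProd.2 hF, fun w hw => ⟨?_, ?_⟩⟩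
  -- An infinite fibre would contain a ball of bad points on which, after shrinking, `f_w` preserves
  -- the `C`-relation; but such a ball contains a good point.
  · by_contra hinf
    obtain ⟨x, hx, γ, hγ⟩ := T.exists_ball_of_infinite
      (A := fun x => (w, x) ∈ X ∧ ¬ G (w, x)) (hF.comp ((DMap.const w).pair DMap.id)) hinf
    obtain ⟨B, hB, hxB, hBX, hiB⟩ := hiso w hw x hx.1
    obtain ⟨γ', hγ'⟩ := hB.exists_radius hxB
    have hC : PreservesC v (fun x => g (w, x)) {y | ((max γ γ' : Γ) : WithTop Γ) < v (y - x)} := by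
      have hsub : ∀ y, ((max γ γ' : Γ) : WithTop Γ) < v (y - x) → y ∈ B := fun y hy =>
        hγ' y ((coe_le_max_right _ _).trans_lt hy)
      have h2 := isCIsoOn_congr (fun y hy => (hgX w y (hBX hy)).symm) hiB
      exact fun y hy z hz t ht => h2.2 y (hsub y hy) z (hsub z hz) t (hsub t ht)
    obtain ⟨b, Δ, α, d, hb, hΔ, hd, h⟩ := T.exists_ball_almost_affine (hgw w) hC
    have hsub : ∀ y, (Δ : WithTop Γ) < v (y - b) → (w, y) ∈ X ∧ ¬ G (w, y) := fun y hy =>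
      hγ y ((coe_le_max_left _ _).trans_lt
        (v_lt_sub_of_lt (lt_of_le_of_lt (by exact_mod_cast hΔ) hy) hb))
    obtain ⟨c, hc⟩ := hv Δ
    refine (hsub b (by rw [sub_self, v.map_zero]; exact WithTop.coe_lt_top _)).2
      ⟨c, v_ne_zero hc, d, v_ne_zero hd, fun y z hy hz => ?_⟩
    rw [hc] at hy hz
    exact ⟨(hsub y hy).1, h y z hy hz⟩
  · rintro x ⟨hxX, hxF⟩
    have hGx : G (w, x) := by
      by_contra hcon
      exact hxF ⟨hxX, hcon⟩
    obtain ⟨c, hc0, d, hd0, h⟩ := hGx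
    obtain ⟨γ, hc⟩ := exists_v_eq (v := v) hc0
    simp only [hc] at h
    obtain ⟨B, hB, hxB, hBX, hiB⟩ := hiso w hw x hxX
    obtain ⟨B', hB', hxB', hB'γ, hJ⟩ := T.exists_hasJacobianProperty (hgw w) hd0
      (fun y z hy hz => (h y z hy hz).2) hB hxB
      (isCIsoOn_congr (fun y hy => (hgX w y (hBX hy)).symm) hiB)
    have hB'X : ∀ y ∈ B', (w, y) ∈ X := fun y hy => (h y y (hB'γ y hy) (hB'γ y hy)).1
    refine ⟨B', hB', hxB', fun y hy => ⟨hB'X y hy, fun hyF => hyF.2 ?_⟩,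
      hasJacobianProperty_congr (fun y hy => hgX w y (hB'X y hy)) hJ⟩
    -- Every point of `B'` is good with the same witnesses, since the ball of radius `γ` around it
    -- lies in the one around `x`.
    refine ⟨c, hc0, d, hd0, fun z t hz ht => ?_⟩
    rw [hc] at hz ht
    have hyγ := hB'γ y hy
    exact h z t (v_lt_sub_of_lt hz hyγ) (v_lt_sub_of_lt ht hyγ)
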